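/- Let $Q_n$ be the Hamming cube, i.e. the graph on $\{0,1\}^n$ in which two strings are adjacent iff they differ in exactly one coordinate, let $N=2^n$ and $\beta=\log_2(3/2)$. An *induced matching* of $Q_n$ is an induced subgraph that is a matching; it is identified with its set of edges. For a vertex $x$ let $x^i$ be the string obtained from $x$ by flipping the $i$th coordinate. A *canonical matching* of $Q_n$ is, for some $i\in\{1,\dots,n\}$ and $\varepsilon\in\{0,1\}$, the set of all edges $xx^i$ with $\sum_{j\ne i}x_j\equiv\varepsilon \pmod 2$. If $M$ is an induced matching of $Q_n$ with $|M|=(1-o(n^{-\beta}))N/4$, then there is a canonical matching $M^*$ of $Q_n$ with $|M\,\triangle\, M^*|=o(N)$ and $|M\cap M^*|=(1-o(1))N/4$. Here the asymptotic terms are as $n\to\infty$ and uniform in $M$. That is: for every function $\delta:\mathbb N\to\mathbb R$ with $\delta(n)=o(n^{-\beta})$ there is a function $\zeta:\mathbb N\to\mathbb R$ with $\zeta(n)\to 0$ such that for every $n\ge 1$ and every induced matching $M$ of $Q_n$ with $|M|\ge(1-\delta(n))N/4$ there is a canonical matching $M^*$ of $Q_n$ with $|M\,\triangle\, M^*|\le\zeta(n)N$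 and $\bigl||M\cap M^*|-N/4\bigr|\le\zeta(n)N/4$. -/

import Mathlib

open scoped symmDiff Asymptotics

/-- The Hamming cube `Q_n`: the graph on `{0,1}^n` (written as vectors over `ZMod 2`) in which two
strings are adjacent iff they differ in exactly one coordinate. -/
def hammingCube (n : ℕ) : SimpleGraph (Fin n → ZMod 2) where
  Adj x y := hammingDist x y = 1
  symm := ⟨fun x y h => (hammingDist_comm y x).trans h⟩
  loopless := ⟨fun x h => by simp at h⟩

/-- The neighbour `x^i` of `x` in direction `i`: the string obtained by flipping the `i`th
coordinate. -/
def flipCoord {n : ℕ} (x : Fin n → ZMod 2) (i : Fin n) : Fin n → ZMod 2 :=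
  Function.update x i (x i + 1)

/-- The canonical matching of direction `i` and parity `ε`: the set of all edges `x x^i` of
direction `i` whose parity, i.e. the parity of `∑_{j ≠ i} x_j`, is `ε`. -/
def canonicalMatching {n : ℕ} (i : Fin n) (ε : ZMod 2) : Set (Sym2 (Fin n → ZMod 2)) :=
  {e | ∃ x : Fin n → ZMod 2, ∑ j ∈ Finset.univ.erase i, x j = ε ∧ e = s(x, flipCoord x i)}

/-- An induced matching of a graph `G`: an induced subgraph of `G` that is a matching (every vertex
of the subgraph lies in exactly one of its edges). -/
def IsInducedMatching {V : Type*} {G : SimpleGraph V} (M : G.Subgraph) : Prop :=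
  M.IsInduced ∧ M.IsMatching

/-! ### Coordinate flips on the cube. -/

section Flips

variable {n : ℕ}

/-! Write β for `isoExp`, W for the vertex set of the matching, and A for W twisted by parity
(`parityTwist`). Adjacent strings have opposite parity, so the boundary edges of A are exactly the
edges with both ends in W or both outside W. As W splits evenly by parity, A has measure exactly
1/2. A canonical matching corresponds to A being a half-cube `x i = c`, so it is enough to show that
A is close to one.

The tool is the isoperimetric inequality E h^β ≥ 2μ(1-μ), where h counts boundary edges at points of
A (`isoperimetric_condAvg`). Vertices of A in W have h = 1. Outside W, h is the number `outDeg` of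
neighbours outside W, and double counting bounds the mean excess of `outDeg` over 1 by nδ. Used
directly, this would require δ = o(1/n). Adjoining `looseSet` to A removes most of this boundary:
vertices with h ≥ 2 then contribute at most 8 n^(β-1) · nδ = 8 n^β δ to E h^β
(`IsPartnered.bdDeg_rpow_le`), which is small exactly when δ = o(n^(-β)).

The inequality is then almost tight, with nearly all of E h^β coming from vertices with h = 1. For
stability, apply it on subcubes in the directions outside I, for every I. The conditional variances
on I and on its complement must add up to almost the whole variance 1/4, so the indicator F is
nearly μ + P + Q with P and Q depending on disjoint sets of coordinates. Since F² = F, one of P and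
Q is nearly zero (`two_mul_projVar_mul_projVar_le`). So every set of directions carries almost none
or almost all of the boundary, one direction carries almost all of it (`exists_jump`), and the set
is close to a half-cube (`exists_halfcube_near`). -/

theorem flipCoord_same (x : Fin n → ZMod 2) (i : Fin n) : flipCoord x i i = x i + 1 := by
  simp [flipCoord]

theorem flipCoord_of_ne (x : Fin n → ZMod 2) {i j : Fin n} (h : j ≠ i) :
    flipCoord x i j = x j := by
  simp [flipCoord, h]

theorem zmod_two_add_one_add_one (a : ZMod 2) : a + 1 + 1 = a := by
  revert a; decide

theorem flipCoord_flipCoord (x : Fin n → ZMod 2) (i : Fin n) :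
    flipCoord (flipCoord x i) i = x := by
  ext j
  by_cases h : j = i
  · subst h; rw [flipCoord_same, flipCoord_same, zmod_two_add_one_add_one]
  · rw [flipCoord_of_ne _ h, flipCoord_of_ne _ h]

theorem flipCoord_comm (x : Fin n → ZMod 2) (i j : Fin n) :
    flipCoord (flipCoord x i) j = flipCoord (flipCoord x j) i := by
  by_cases hij : i = j
  · rw [hij]
  · ext k
    by_cases hi : k = i
    · subst hi
      rw [flipCoord_of_ne _ hij, flipCoord_same, flipCoord_same, flipCoord_of_ne _ hij]
    · by_cases hj : k = j
      · subst hj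
        rw [flipCoord_same, flipCoord_of_ne _ hi, flipCoord_of_ne _ hi, flipCoord_same]
      · rw [flipCoord_of_ne _ hj, flipCoord_of_ne _ hi, flipCoord_of_ne _ hi,
          flipCoord_of_ne _ hj]

theorem flipCoord_injective_right (x : Fin n → ZMod 2) : Function.Injective (flipCoord x) := by
  intro i j h
  by_contra hij
  have := congrFun h i
  rw [flipCoord_same, flipCoord_of_ne _ hij] at this
  revert this
  generalize x i = a
  revert a
  decide

theorem sum_flipCoord (x : Fin n → ZMod 2) (i : Fin n) :
    ∑ j, flipCoord x i j = ∑ j, x j + 1 := by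
  rw [← Finset.add_sum_erase _ _ (Finset.mem_univ i),
    ← Finset.add_sum_erase (a := i) _ x (Finset.mem_univ i), flipCoord_same,
    Finset.sum_congr rfl fun j hj => flipCoord_of_ne x (Finset.ne_of_mem_erase hj)]
  ring

/-- Flipping the `i`th coordinate, as a permutation of the cube. -/
def flipEquiv (i : Fin n) : (Fin n → ZMod 2) ≃ (Fin n → ZMod 2) where
  toFun x := flipCoord x i
  invFun x := flipCoord x i
  left_inv x := flipCoord_flipCoord x i
  right_inv x := flipCoord_flipCoord x i

theorem sum_comp_flipCoord {R : Type*} [AddCommMonoid R] (f : (Fin n → ZMod 2) → R) (i : Fin n) :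
    ∑ x, f (flipCoord x i) = ∑ x, f x :=
  Equiv.sum_comp (flipEquiv i) f

theorem hammingDist_eq_one_iff (x y : Fin n → ZMod 2) :
    hammingDist x y = 1 ↔ ∃ i, y = flipCoord x i := by
  unfold hammingDist
  rw [Finset.card_eq_one]
  constructor
  · rintro ⟨i, hi⟩
    refine ⟨i, ?_⟩
    ext j
    have hj := Finset.ext_iff.1 hi j
    simp only [Finset.mem_filter, Finset.mem_univ, true_and, Finset.mem_singleton] at hj
    by_cases h : j = i
    · subst h
      rw [flipCoord_same]
      have h1 : x j ≠ y j := hj.2 rfl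
      revert h1
      generalize x j = a
      generalize y j = b
      revert a b
      decide
    · rw [flipCoord_of_ne _ h]
      by_contra h1
      exact h (hj.1 fun h2 => h1 h2.symm)
  · rintro ⟨i, rfl⟩
    refine ⟨i, ?_⟩
    ext j
    simp only [Finset.mem_filter, Finset.mem_univ, true_and, Finset.mem_singleton]
    by_cases h : j = i
    · subst h
      rw [flipCoord_same]
      generalize x j = a
      revert a
      simp
    · rw [flipCoord_of_ne _ h]
      simp [h]

/-- The string obtained from `x` by flipping all coordinates in `S`. -/
def flipSet (x : Fin n → ZMod 2) (S : Finset (Fin n)) : Fin n → ZMod 2 :=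
  fun j => if j ∈ S then x j + 1 else x j

theorem flipSet_empty (x : Fin n → ZMod 2) : flipSet x ∅ = x := by
  ext j; simp [flipSet]

theorem flipSet_insert (x : Fin n → ZMod 2) {i : Fin n} {S : Finset (Fin n)} (h : i ∉ S) :
    flipSet x (insert i S) = flipSet (flipCoord x i) S := by
  ext j
  by_cases hj : j = i
  · subst hj; simp [flipSet, h, flipCoord_same]
  · simp [flipSet, hj, flipCoord_of_ne]

theorem eq_of_flipCoord_invariant {α : Type*} {f : (Fin n → ZMod 2) → α}
    (h : ∀ i x, f (flipCoord x i) = f x) (x y : Fin n → ZMod 2) : f x = f y := by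
  have key : ∀ S : Finset (Fin n), ∀ x, f (flipSet x S) = f x := by
    intro S
    induction S using Finset.induction_on with
    | empty => intro x; rw [flipSet_empty]
    | insert i S hi ih => intro x; rw [flipSet_insert x hi, ih, h]
  have hy : y = flipSet x (Finset.univ.filter fun j => x j ≠ y j) := by
    ext j
    by_cases hj : x j = y j
    · simp [flipSet, hj]
    · simp only [flipSet, Finset.mem_filter, Finset.mem_univ, true_and, ne_eq, hj,
        not_false_eq_true, if_true]
      revert hj
      generalize x j = a
      generalize y j = b
      revert a b
      decide
  rw [hy, key]

end Flips

/-! ### Averages over the cube and over subcubes. -/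

section Averages

variable {n : ℕ}

/-- The average of `f` over the cube. -/
noncomputable def cubeAvg (f : (Fin n → ZMod 2) → ℝ) : ℝ :=
  (∑ x, f x) / 2 ^ n

theorem card_cube : Fintype.card (Fin n → ZMod 2) = 2 ^ n := by
  simp [ZMod.card]

theorem cubeAvg_const (c : ℝ) : cubeAvg (fun _ : Fin n → ZMod 2 => c) = c := by
  unfold cubeAvg
  rw [Finset.sum_const, Finset.card_univ, card_cube, nsmul_eq_mul]
  push_cast
  field_simp

theorem cubeAvg_add (f g : (Fin n → ZMod 2) → ℝ) :
    cubeAvg (fun x => f x + g x) = cubeAvg f + cubeAvg g := by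
  unfold cubeAvg
  rw [Finset.sum_add_distrib, add_div]

theorem cubeAvg_sub (f g : (Fin n → ZMod 2) → ℝ) :
    cubeAvg (fun x => f x - g x) = cubeAvg f - cubeAvg g := by
  unfold cubeAvg
  rw [Finset.sum_sub_distrib, sub_div]

theorem cubeAvg_const_mul (c : ℝ) (f : (Fin n → ZMod 2) → ℝ) :
    cubeAvg (fun x => c * f x) = c * cubeAvg f := by
  unfold cubeAvg
  rw [← Finset.mul_sum, mul_div_assoc]

theorem cubeAvg_mono {f g : (Fin n → ZMod 2) → ℝ} (h : ∀ x, f x ≤ g x) :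
    cubeAvg f ≤ cubeAvg g := by
  unfold cubeAvg
  gcongr with x
  exact h x

theorem cubeAvg_nonneg {f : (Fin n → ZMod 2) → ℝ} (h : ∀ x, 0 ≤ f x) : 0 ≤ cubeAvg f := by
  unfold cubeAvg
  exact div_nonneg (Finset.sum_nonneg fun x _ => h x) (by positivity)

theorem cubeAvg_comp_flipCoord (f : (Fin n → ZMod 2) → ℝ) (i : Fin n) :
    cubeAvg (fun x => f (flipCoord x i)) = cubeAvg f := by
  unfold cubeAvg
  rw [sum_comp_flipCoord]

/-- The average of `f` over the subcube through `x` spanned by the directions in `K`. -/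
noncomputable def condAvg (K : Finset (Fin n)) (f : (Fin n → ZMod 2) → ℝ)
    (x : Fin n → ZMod 2) : ℝ :=
  (∑ S ∈ K.powerset, f (flipSet x S)) / 2 ^ K.card

theorem condAvg_empty (f : (Fin n → ZMod 2) → ℝ) (x : Fin n → ZMod 2) :
    condAvg ∅ f x = f x := by
  simp [condAvg, flipSet_empty]

theorem condAvg_insert {i : Fin n} {K : Finset (Fin n)} (hi : i ∉ K)
    (f : (Fin n → ZMod 2) → ℝ) (x : Fin n → ZMod 2) :
    condAvg (insert i K) f x = (condAvg K f x + condAvg K f (flipCoord x i)) / 2 := by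
  unfold condAvg
  rw [Finset.sum_powerset_insert hi, Finset.card_insert_of_notMem hi, pow_succ]
  have : ∑ S ∈ K.powerset, f (flipSet x (insert i S))
      = ∑ S ∈ K.powerset, f (flipSet (flipCoord x i) S) := by
    refine Finset.sum_congr rfl fun S hS => ?_
    rw [flipSet_insert x fun h => hi (Finset.mem_powerset.1 hS h)]
  rw [this]
  field_simp

theorem condAvg_mono {K : Finset (Fin n)} {f g : (Fin n → ZMod 2) → ℝ} (h : ∀ x, f x ≤ g x)
    (x : Fin n → ZMod 2) : condAvg K f x ≤ condAvg K g x := by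
  unfold condAvg
  gcongr
  exact h _

theorem condAvg_add (K : Finset (Fin n)) (f g : (Fin n → ZMod 2) → ℝ) (x : Fin n → ZMod 2) :
    condAvg K (fun y => f y + g y) x = condAvg K f x + condAvg K g x := by
  unfold condAvg
  rw [Finset.sum_add_distrib, add_div]

theorem condAvg_sub (K : Finset (Fin n)) (f g : (Fin n → ZMod 2) → ℝ) (x : Fin n → ZMod 2) :
    condAvg K (fun y => f y - g y) x = condAvg K f x - condAvg K g x := by
  unfold condAvg
  rw [Finset.sum_sub_distrib, sub_div]

theorem condAvg_const_mul (K : Finset (Fin n)) (c : ℝ) (f : (Fin n → ZMod 2) → ℝ)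
    (x : Fin n → ZMod 2) : condAvg K (fun y => c * f y) x = c * condAvg K f x := by
  unfold condAvg
  rw [← Finset.mul_sum, mul_div_assoc]

theorem condAvg_const (K : Finset (Fin n)) (c : ℝ) (x : Fin n → ZMod 2) :
    condAvg K (fun _ => c) x = c := by
  unfold condAvg
  rw [Finset.sum_const, Finset.card_powerset, nsmul_eq_mul]
  push_cast
  field_simp

theorem condAvg_comp_flipCoord (K : Finset (Fin n)) (f : (Fin n → ZMod 2) → ℝ) (i : Fin n)
    (x : Fin n → ZMod 2) :
    condAvg K (fun y => f (flipCoord y i)) x = condAvg K f (flipCoord x i) := by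
  induction K using Finset.induction_on generalizing x with
  | empty => simp only [condAvg_empty]
  | insert j K hj ih => rw [condAvg_insert hj, condAvg_insert hj, ih, ih, flipCoord_comm]

theorem cubeAvg_condAvg (K : Finset (Fin n)) (f : (Fin n → ZMod 2) → ℝ) :
    cubeAvg (condAvg K f) = cubeAvg f := by
  induction K using Finset.induction_on with
  | empty => exact congrArg _ (funext (condAvg_empty f))
  | insert i K hi ih =>
    have h1 : condAvg (insert i K) f
        = fun x => (1 / 2) * (condAvg K f x + condAvg K f (flipCoord x i)) := by
      funext x; rw [condAvg_insert hi]; ring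
    rw [h1, cubeAvg_const_mul, cubeAvg_add, cubeAvg_comp_flipCoord, ih]
    ring

theorem condAvg_flipCoord_of_mem {K : Finset (Fin n)} {i : Fin n} (hi : i ∈ K)
    (f : (Fin n → ZMod 2) → ℝ) (x : Fin n → ZMod 2) :
    condAvg K f (flipCoord x i) = condAvg K f x := by
  rw [← Finset.insert_erase hi, condAvg_insert (Finset.notMem_erase i K),
    condAvg_insert (Finset.notMem_erase i K), flipCoord_flipCoord, add_comm]

theorem condAvg_flipCoord_of_invariant (K : Finset (Fin n)) {i : Fin n}
    {f : (Fin n → ZMod 2) → ℝ} (hf : ∀ x, f (flipCoord x i) = f x) (x : Fin n → ZMod 2) :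
    condAvg K f (flipCoord x i) = condAvg K f x := by
  rw [← condAvg_comp_flipCoord]
  simp only [hf]

theorem condAvg_mul_of_invariant {K : Finset (Fin n)} {g : (Fin n → ZMod 2) → ℝ}
    (hg : ∀ i ∈ K, ∀ x, g (flipCoord x i) = g x) (f : (Fin n → ZMod 2) → ℝ)
    (x : Fin n → ZMod 2) : condAvg K (fun y => g y * f y) x = g x * condAvg K f x := by
  induction K using Finset.induction_on generalizing x with
  | empty => simp only [condAvg_empty]
  | insert j K hj ih =>
    have ih' := ih fun i hi => hg i (Finset.mem_insert_of_mem hi)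
    rw [condAvg_insert hj, condAvg_insert hj, ih', ih', hg j (Finset.mem_insert_self j K)]
    ring

/-- A function which does not depend on the coordinates outside `K` has constant
conditional average over `K`. -/
theorem condAvg_eq_cubeAvg {K : Finset (Fin n)} {f : (Fin n → ZMod 2) → ℝ}
    (hf : ∀ i ∉ K, ∀ x, f (flipCoord x i) = f x) (x : Fin n → ZMod 2) :
    condAvg K f x = cubeAvg f := by
  have h : ∀ i y, condAvg K f (flipCoord y i) = condAvg K f y := by
    intro i y
    by_cases hi : i ∈ K
    · exact condAvg_flipCoord_of_mem hi f y
    · exact condAvg_flipCoord_of_invariant K (hf i hi) y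
  have h2 : condAvg K f = fun _ => condAvg K f x :=
    funext fun y => eq_of_flipCoord_invariant h y x
  rw [← cubeAvg_condAvg K f, h2, cubeAvg_const]

/-- Functions of complementary sets of coordinates are independent. -/
theorem cubeAvg_mul_of_invariant {K : Finset (Fin n)} {f g : (Fin n → ZMod 2) → ℝ}
    (hg : ∀ i ∈ K, ∀ x, g (flipCoord x i) = g x) (hf : ∀ i ∉ K, ∀ x, f (flipCoord x i) = f x) :
    cubeAvg (fun x => g x * f x) = cubeAvg g * cubeAvg f := by
  rw [← cubeAvg_condAvg K]
  have : condAvg K (fun x => g x * f x) = fun x => cubeAvg f * g x := by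
    funext x
    rw [condAvg_mul_of_invariant hg, condAvg_eq_cubeAvg hf, mul_comm]
  rw [this, cubeAvg_const_mul, mul_comm]

/-- `condAvg K` is a self-adjoint projection. -/
theorem cubeAvg_condAvg_mul_self (K : Finset (Fin n)) (f : (Fin n → ZMod 2) → ℝ) :
    cubeAvg (fun x => condAvg K f x * f x) = cubeAvg (fun x => condAvg K f x ^ 2) := by
  rw [← cubeAvg_condAvg K (fun x => condAvg K f x * f x)]
  congr 1
  funext x
  rw [condAvg_mul_of_invariant fun i hi x => condAvg_flipCoord_of_mem hi f x, sq]

end Averages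

/-! ### The isoperimetric inequality with exponent log₂(3/2). -/

section Isoperimetry

variable {n : ℕ}

/-- The exponent `log₂ (3/2)`. -/
noncomputable def isoExp : ℝ := Real.logb 2 (3 / 2)

theorem two_rpow_isoExp : (2 : ℝ) ^ isoExp = 3 / 2 :=
  Real.rpow_logb (by norm_num) (by norm_num) (by norm_num)

theorem half_lt_isoExp : 1 / 2 < isoExp := by
  unfold isoExp
  rw [Real.lt_logb_iff_rpow_lt (by norm_num) (by norm_num), ← Real.sqrt_eq_rpow,
    Real.sqrt_lt' (by norm_num)]
  norm_num

theorem isoExp_lt_one : isoExp < 1 := by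
  unfold isoExp
  rw [Real.logb_lt_iff_lt_rpow (by norm_num) (by norm_num)]
  norm_num

theorem isoExp_pos : 0 < isoExp := by linarith [half_lt_isoExp]

/-- Weighted concavity of `t ↦ t ^ isoExp`. -/
theorem weighted_add_rpow_le {θ h : ℝ} (h0 : 0 < θ) (h1 : θ < 1) (hh : 0 ≤ h) :
    θ ^ (1 - isoExp) * h ^ isoExp + (1 - θ) ^ (1 - isoExp) ≤ (h + 1) ^ isoExp := by
  have hc := (Real.concaveOn_rpow isoExp_pos.le isoExp_lt_one.le).2
    (show h / θ ∈ Set.Ici 0 from div_nonneg hh h0.le)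
    (show 1 / (1 - θ) ∈ Set.Ici 0 from div_nonneg zero_le_one (sub_nonneg.2 h1.le))
    h0.le (show 0 ≤ 1 - θ by linarith) (by ring)
  have h1' : 0 < 1 - θ := by linarith
  simp only [smul_eq_mul] at hc
  rw [mul_div_cancel₀ _ h0.ne', mul_div_cancel₀ _ h1'.ne', Real.div_rpow hh h0.le,
    Real.div_rpow zero_le_one h1'.le, Real.one_rpow] at hc
  rw [Real.rpow_sub h0, Real.rpow_sub h1', Real.rpow_one, Real.rpow_one]
  calc _ = _ := by ring
    _ ≤ _ := hc

/-- The right side is concave in v and the left is its chord, since the values at v = 0 and v = 1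
are 1 and 2^β = 3/2. This is where the value of β enters. -/
theorem one_add_half_le_rpow {v : ℝ} (h0 : 0 ≤ v) (h1 : v ≤ 1) :
    1 + v / 2 ≤ (1 + v) ^ isoExp := by
  have hc := (Real.concaveOn_rpow isoExp_pos.le isoExp_lt_one.le).2
    (show (1 : ℝ) ∈ Set.Ici 0 from zero_le_one (α := ℝ)) (show (2 : ℝ) ∈ Set.Ici 0 from zero_le_two (α := ℝ))
    (show 0 ≤ 1 - v by linarith) h0 (by ring)
  simp only [smul_eq_mul] at hc
  rw [Real.one_rpow, two_rpow_isoExp] at hc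
  calc 1 + v / 2 = (1 - v) * 1 + v * (3 / 2) := by ring
    _ ≤ _ := hc
    _ = _ := by congr 1; ring

theorem half_rpow_add_one_le (h : ℕ) :
    1 / 2 * (h : ℝ) ^ isoExp + 1 ≤ ((h : ℝ) + 1) ^ isoExp := by
  rcases Nat.eq_zero_or_pos h with rfl | hpos
  · simp [Real.zero_rpow isoExp_pos.ne']
  · have hw := weighted_add_rpow_le (θ := 1 / 2) (h := h) (by norm_num) (by norm_num)
      (Nat.cast_nonneg h)
    have h2 : (1 / 2 : ℝ) ^ (1 - isoExp) = 3 / 4 := by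
      rw [Real.rpow_sub (by norm_num), Real.div_rpow (by norm_num) (by norm_num),
        Real.div_rpow (by norm_num) (by norm_num), two_rpow_isoExp]
      norm_num
    have h3 : (1 : ℝ) - 1 / 2 = 1 / 2 := by norm_num
    rw [h3, h2] at hw
    have h4 : (1 : ℝ) ≤ (h : ℝ) ^ isoExp :=
      Real.one_le_rpow (by exact_mod_cast hpos) isoExp_pos.le
    linarith

/-- Weighted concavity with θ = 1/(1+s²). The constant term carries the factor s^(2(1-β)), which is
at least s because s ≤ 1 and β > 1/2. -/
theorem rpow_add_le_mul_rpow {s : ℝ} (h0 : 0 < s) (h1 : s ≤ 1) {h : ℝ} (hh : 0 ≤ h) :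
    (1 + s ^ 2) ^ (isoExp - 1) * h ^ isoExp + s * (1 + s ^ 2) ^ (isoExp - 1)
      ≤ (h + 1) ^ isoExp := by
  have hZ : 0 < 1 + s ^ 2 := by positivity
  have hw := weighted_add_rpow_le (θ := (1 + s ^ 2)⁻¹) (h := h) (by positivity)
    (inv_lt_one_of_one_lt₀ (by nlinarith)) hh
  have e1 : ((1 + s ^ 2)⁻¹ : ℝ) ^ (1 - isoExp) = (1 + s ^ 2) ^ (isoExp - 1) := by
    rw [Real.inv_rpow hZ.le, ← Real.rpow_neg hZ.le, neg_sub]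
  have e2 : (1 - (1 + s ^ 2)⁻¹ : ℝ) = s ^ 2 * (1 + s ^ 2)⁻¹ := by field_simp; ring
  have e3 : s ≤ (s ^ 2) ^ (1 - isoExp) := by
    rw [← Real.rpow_natCast s 2, ← Real.rpow_mul h0.le]
    calc s = s ^ (1 : ℝ) := (Real.rpow_one s).symm
      _ ≤ _ := Real.rpow_le_rpow_of_exponent_ge h0 h1 (by
        push_cast; linarith [half_lt_isoExp])
  rw [e2, Real.mul_rpow (by positivity) (by positivity), e1] at hw
  have : s * (1 + s ^ 2) ^ (isoExp - 1) ≤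
      (s ^ 2) ^ (1 - isoExp) * (1 + s ^ 2) ^ (isoExp - 1) := by gcongr
  linarith

/-- The numerical core of the induction on dimension: a is the mean on the denser half and d the
drop to the other half. Replacing (h+1)^β by a linear function of h^β lets the induction hypothesis
be averaged, and the gain must be d². -/
theorem exists_linear_minorant {a d : ℝ} (hd : 0 ≤ d) (hda : d ≤ a) :
    ∃ p q : ℝ, 0 ≤ p ∧ p ≤ 1 ∧ 0 ≤ q ∧
      (∀ h : ℕ, p * (h : ℝ) ^ isoExp + q ≤ ((h : ℝ) + 1) ^ isoExp) ∧
      2 * a * (1 - a) + d ^ 2 ≤ p * (2 * a * (1 - a)) + q * d := by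
  rcases hd.eq_or_lt with rfl | hd0
  · refine ⟨1, 0, zero_le_one, le_rfl, le_rfl, fun h => ?_, by simp⟩
    rw [one_mul, add_zero]
    exact Real.rpow_le_rpow (Nat.cast_nonneg h) (by linarith) isoExp_pos.le
  rcases le_total d (1 / 2) with hd2 | hd2
  · have hs0 : 0 < 2 * d := by linarith
    have hZ : (1 : ℝ) ≤ 1 + (2 * d) ^ 2 := by nlinarith
    have hp1 : (1 + (2 * d) ^ 2) ^ (isoExp - 1) ≤ 1 :=
      Real.rpow_le_one_of_one_le_of_nonpos hZ (by linarith [isoExp_lt_one])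
    -- With s = 2d and p ≤ 1 the worst case is a = 1/2, where the claim becomes (1+s²)^β ≥ 1 + s²/2.
    refine ⟨(1 + (2 * d) ^ 2) ^ (isoExp - 1), 2 * d * (1 + (2 * d) ^ 2) ^ (isoExp - 1),
      by positivity, hp1, by positivity,
      fun h => rpow_add_le_mul_rpow hs0 (by linarith) (Nat.cast_nonneg h), ?_⟩
    have h1 := one_add_half_le_rpow (v := (2 * d) ^ 2) (by positivity) (by nlinarith)
    have h2 : (1 + (2 * d) ^ 2) ^ isoExp
        = (1 + (2 * d) ^ 2) ^ (isoExp - 1) * (1 + (2 * d) ^ 2) := by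
      rw [Real.rpow_sub_one (by positivity)]
      field_simp
    rw [h2] at h1
    generalize (1 + (2 * d) ^ 2) ^ (isoExp - 1) = p at *
    nlinarith [mul_nonneg (sub_nonneg.2 hp1) (sq_nonneg (2 * a - 1))]
  -- Here 1/2 ≤ d ≤ a, so the claim reduces to a(1-a) ≤ d(1-d).
  · refine ⟨1 / 2, 1, by norm_num, by norm_num, zero_le_one, half_rpow_add_one_le, ?_⟩
    nlinarith

/-- The indicator function of a set of strings. -/
def ind (A : Finset (Fin n → ZMod 2)) (x : Fin n → ZMod 2) : ℝ := if x ∈ A then 1 else 0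

/-- For `x ∈ A`, the number of directions in `K` along which `x` has a neighbour outside `A`. -/
def bdDeg (A : Finset (Fin n → ZMod 2)) (K : Finset (Fin n)) (x : Fin n → ZMod 2) : ℕ :=
  if x ∈ A then (K.filter fun i => flipCoord x i ∉ A).card else 0

theorem ind_nonneg (A : Finset (Fin n → ZMod 2)) (x : Fin n → ZMod 2) : 0 ≤ ind A x := by
  unfold ind; split_ifs <;> norm_num

theorem ind_le_one (A : Finset (Fin n → ZMod 2)) (x : Fin n → ZMod 2) : ind A x ≤ 1 := by
  unfold ind; split_ifs <;> norm_num

theorem condAvg_ind_nonneg (A : Finset (Fin n → ZMod 2)) (K : Finset (Fin n))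
    (x : Fin n → ZMod 2) : 0 ≤ condAvg K (ind A) x := by
  rw [← condAvg_const K 0 x]
  exact condAvg_mono (ind_nonneg A) x

theorem condAvg_ind_le_one (A : Finset (Fin n → ZMod 2)) (K : Finset (Fin n))
    (x : Fin n → ZMod 2) : condAvg K (ind A) x ≤ 1 := by
  rw [← condAvg_const K 1 x]
  exact condAvg_mono (ind_le_one A) x

theorem bdDeg_insert {A : Finset (Fin n → ZMod 2)} {K : Finset (Fin n)} {i : Fin n} (hi : i ∉ K)
    (x : Fin n → ZMod 2) : bdDeg A (insert i K) x = bdDeg A K x + bdDeg A {i} x := by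
  unfold bdDeg
  split_ifs
  · rw [Finset.filter_insert, Finset.filter_singleton]
    split_ifs
    · simp
    · rw [Finset.card_insert_of_notMem (by simp [hi]), Finset.card_singleton]
  · rfl

theorem bdDeg_singleton_le_one (A : Finset (Fin n → ZMod 2)) (i : Fin n) (x : Fin n → ZMod 2) :
    bdDeg A {i} x ≤ 1 := by
  unfold bdDeg
  split_ifs
  · exact (Finset.card_filter_le _ _).trans (by simp)
  · exact zero_le_one

theorem ind_sub_ind_le_bdDeg (A : Finset (Fin n → ZMod 2)) (i : Fin n) (x : Fin n → ZMod 2) :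
    ind A x - ind A (flipCoord x i) ≤ bdDeg A {i} x := by
  unfold ind bdDeg
  rw [Finset.filter_singleton]
  by_cases h1 : x ∈ A <;> by_cases h2 : flipCoord x i ∈ A <;> simp [h1, h2]

/-- On the denser half, at least a proportion d of the points are in A with their i-neighbour
outside A. These extra boundary edges supply the gain d². -/
theorem condAvg_bdDeg_insert_ge {A : Finset (Fin n → ZMod 2)} {K : Finset (Fin n)} {i : Fin n}
    (hi : i ∉ K) (x : Fin n → ZMod 2)
    (ih : 2 * condAvg K (ind A) x * (1 - condAvg K (ind A) x)
      ≤ condAvg K (fun y => (bdDeg A K y : ℝ) ^ isoExp) x)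
    (hle : condAvg K (ind A) (flipCoord x i) ≤ condAvg K (ind A) x) :
    2 * condAvg K (ind A) x * (1 - condAvg K (ind A) x)
        + (condAvg K (ind A) x - condAvg K (ind A) (flipCoord x i)) ^ 2
      ≤ condAvg K (fun y => (bdDeg A (insert i K) y : ℝ) ^ isoExp) x := by
  obtain ⟨p, q, hp0, hp1, hq0, hpq, hmain⟩ :=
    exists_linear_minorant (a := condAvg K (ind A) x)
      (d := condAvg K (ind A) x - condAvg K (ind A) (flipCoord x i)) (by linarith)
      (by linarith [condAvg_ind_nonneg A K (flipCoord x i)])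
  have hpt : ∀ y, p * (bdDeg A K y : ℝ) ^ isoExp + q * (bdDeg A {i} y : ℝ)
      ≤ (bdDeg A (insert i K) y : ℝ) ^ isoExp := by
    intro y
    rw [bdDeg_insert hi]
    have h1 := bdDeg_singleton_le_one A i y
    interval_cases bdDeg A {i} y
    · have : (0 : ℝ) ≤ (bdDeg A K y : ℝ) ^ isoExp := by positivity
      push_cast
      rw [add_zero]
      nlinarith
    · have := hpq (bdDeg A K y)
      push_cast
      linarith
  have hd : condAvg K (ind A) x - condAvg K (ind A) (flipCoord x i)
      ≤ condAvg K (fun y => (bdDeg A {i} y : ℝ)) x := by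
    rw [← condAvg_comp_flipCoord, ← condAvg_sub]
    exact condAvg_mono (ind_sub_ind_le_bdDeg A i) x
  have h2 := condAvg_mono (K := K) hpt x
  rw [condAvg_add, condAvg_const_mul, condAvg_const_mul] at h2
  have h3 := mul_le_mul_of_nonneg_left ih hp0
  have h4 := mul_le_mul_of_nonneg_left hd hq0
  linarith

/-- The Kahn–Park isoperimetric inequality, on the subcube through `x` spanned by `K`. -/
theorem isoperimetric_condAvg (A : Finset (Fin n → ZMod 2)) (K : Finset (Fin n))
    (x : Fin n → ZMod 2) :
    2 * condAvg K (ind A) x * (1 - condAvg K (ind A) x)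
      ≤ condAvg K (fun y => (bdDeg A K y : ℝ) ^ isoExp) x := by
  induction K using Finset.induction_on generalizing x with
  | empty =>
    rw [condAvg_empty, condAvg_empty]
    have : (0 : ℝ) ≤ (bdDeg A ∅ x : ℝ) ^ isoExp := by positivity
    unfold ind
    split_ifs <;> linarith
  | insert i K hi ih =>
    have hmono : ∀ y, condAvg K (fun y => (bdDeg A K y : ℝ) ^ isoExp) y
        ≤ condAvg K (fun y => (bdDeg A (insert i K) y : ℝ) ^ isoExp) y := by
      refine fun y => condAvg_mono (fun z => ?_) y
      refine Real.rpow_le_rpow (Nat.cast_nonneg _) ?_ isoExp_pos.le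
      rw [bdDeg_insert hi]
      push_cast
      linarith [Nat.cast_nonneg (α := ℝ) (bdDeg A {i} z)]
    rw [condAvg_insert hi, condAvg_insert hi]
    -- For half-means a and b, 2m(1-m) at m = (a+b)/2 exceeds the average of its values at a and b
    -- by (a-b)²/2. Only the denser half has to supply this, hence d² there.
    rcases le_total (condAvg K (ind A) (flipCoord x i)) (condAvg K (ind A) x) with hle | hle
    · have h1 := condAvg_bdDeg_insert_ge hi x (ih x) hle
      have h2 := (ih (flipCoord x i)).trans (hmono _)
      nlinarith
    · have h1 := condAvg_bdDeg_insert_ge hi (flipCoord x i) (ih _)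
        (by rw [flipCoord_flipCoord]; exact hle)
      rw [flipCoord_flipCoord] at h1
      have h2 := (ih x).trans (hmono _)
      nlinarith

end Isoperimetry

/-! ### Stability of the isoperimetric inequality. -/

section Stability

variable {n : ℕ}

/-- The centred part of the indicator of `A` that depends only on the coordinates in `I`. -/
noncomputable def projPart (A : Finset (Fin n → ZMod 2)) (I : Finset (Fin n))
    (x : Fin n → ZMod 2) : ℝ :=
  condAvg Iᶜ (ind A) x - cubeAvg (ind A)

/-- The variance of `projPart A I`. -/
noncomputable def projVar (A : Finset (Fin n → ZMod 2)) (I : Finset (Fin n)) : ℝ :=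
  cubeAvg fun x => projPart A I x ^ 2

theorem cubeAvg_ind_nonneg (A : Finset (Fin n → ZMod 2)) : 0 ≤ cubeAvg (ind A) :=
  cubeAvg_nonneg (ind_nonneg A)

theorem cubeAvg_ind_le_one (A : Finset (Fin n → ZMod 2)) : cubeAvg (ind A) ≤ 1 := by
  rw [← cubeAvg_const (n := n) 1]
  exact cubeAvg_mono (ind_le_one A)

theorem projVar_nonneg (A : Finset (Fin n → ZMod 2)) (I : Finset (Fin n)) : 0 ≤ projVar A I :=
  cubeAvg_nonneg fun _ => sq_nonneg _

theorem cubeAvg_projPart (A : Finset (Fin n → ZMod 2)) (I : Finset (Fin n)) :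
    cubeAvg (projPart A I) = 0 := by
  have : projPart A I = fun x => condAvg Iᶜ (ind A) x - cubeAvg (ind A) := rfl
  rw [this, cubeAvg_sub, cubeAvg_condAvg, cubeAvg_const, sub_self]

theorem projPart_flipCoord (A : Finset (Fin n → ZMod 2)) {I : Finset (Fin n)} {i : Fin n}
    (hi : i ∈ Iᶜ) (x : Fin n → ZMod 2) : projPart A I (flipCoord x i) = projPart A I x := by
  unfold projPart
  rw [condAvg_flipCoord_of_mem hi]

theorem projPart_compl_flipCoord (A : Finset (Fin n → ZMod 2)) {I : Finset (Fin n)} {i : Fin n}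
    (hi : i ∉ Iᶜ) (x : Fin n → ZMod 2) : projPart A Iᶜ (flipCoord x i) = projPart A Iᶜ x :=
  projPart_flipCoord A (Finset.mem_compl.2 hi) x

theorem projPart_mem_Icc (A : Finset (Fin n → ZMod 2)) (I : Finset (Fin n))
    (x : Fin n → ZMod 2) : -1 ≤ projPart A I x ∧ projPart A I x ≤ 1 := by
  unfold projPart
  constructor <;>
    linarith [condAvg_ind_nonneg A Iᶜ x, condAvg_ind_le_one A Iᶜ x, cubeAvg_ind_nonneg A,
      cubeAvg_ind_le_one A]

theorem projVar_eq (A : Finset (Fin n → ZMod 2)) (I : Finset (Fin n)) :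
    projVar A I = cubeAvg (fun x => condAvg Iᶜ (ind A) x ^ 2) - cubeAvg (ind A) ^ 2 := by
  have : (fun x => projPart A I x ^ 2) = fun x => condAvg Iᶜ (ind A) x ^ 2
      - 2 * cubeAvg (ind A) * condAvg Iᶜ (ind A) x + cubeAvg (ind A) ^ 2 := by
    funext x; unfold projPart; ring
  rw [projVar, this, cubeAvg_add, cubeAvg_sub, cubeAvg_const_mul, cubeAvg_condAvg, cubeAvg_const]
  ring

theorem cubeAvg_projPart_mul_ind (A : Finset (Fin n → ZMod 2)) (I : Finset (Fin n)) :
    cubeAvg (fun x => projPart A I x * ind A x) = projVar A I := by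
  have : (fun x => projPart A I x * ind A x) = fun x => condAvg Iᶜ (ind A) x * ind A x
      - cubeAvg (ind A) * ind A x := by
    funext x; unfold projPart; ring
  rw [this, cubeAvg_sub, cubeAvg_const_mul, cubeAvg_condAvg_mul_self, projVar_eq, sq (cubeAvg _)]

theorem cubeAvg_projPart_pow_mul (A : Finset (Fin n → ZMod 2)) (I : Finset (Fin n)) (k l : ℕ) :
    cubeAvg (fun x => projPart A I x ^ k * projPart A Iᶜ x ^ l)
      = cubeAvg (fun x => projPart A I x ^ k) * cubeAvg (fun x => projPart A Iᶜ x ^ l) :=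
  cubeAvg_mul_of_invariant (K := Iᶜ)
    (fun i hi x => by simp only [projPart_flipCoord A hi])
    (fun i hi x => by simp only [projPart_compl_flipCoord A hi])

theorem cubeAvg_projPart_pow_one (A : Finset (Fin n → ZMod 2)) (I : Finset (Fin n)) :
    cubeAvg (fun x => projPart A I x ^ 1) = 0 := by
  simp only [pow_one]
  exact cubeAvg_projPart A I

/-- Averaging over the subcubes in the directions outside I replaces μ(1-μ) by its mean conditional
version, which falls short by the variance of the conditional mean. -/
theorem cubeAvg_isoperimetric (A : Finset (Fin n → ZMod 2)) (I : Finset (Fin n)) :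
    2 * (cubeAvg (ind A) * (1 - cubeAvg (ind A)) - projVar A I)
      ≤ cubeAvg fun x => (bdDeg A Iᶜ x : ℝ) ^ isoExp := by
  have h := cubeAvg_mono (isoperimetric_condAvg A Iᶜ)
  rw [cubeAvg_condAvg] at h
  have e : (fun x => 2 * condAvg Iᶜ (ind A) x * (1 - condAvg Iᶜ (ind A) x))
      = fun x => 2 * condAvg Iᶜ (ind A) x - 2 * condAvg Iᶜ (ind A) x ^ 2 := by
    funext x; ring
  rw [e, cubeAvg_sub, cubeAvg_const_mul, cubeAvg_const_mul, cubeAvg_condAvg] at h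
  rw [projVar_eq]
  linarith

/-- What remains of the indicator of `A` after subtracting the parts depending on `I` and on its
complement only. -/
noncomputable def projRest (A : Finset (Fin n → ZMod 2)) (I : Finset (Fin n))
    (x : Fin n → ZMod 2) : ℝ :=
  ind A x - cubeAvg (ind A) - projPart A I x - projPart A Iᶜ x

theorem ind_sq (A : Finset (Fin n → ZMod 2)) (x : Fin n → ZMod 2) : ind A x ^ 2 = ind A x := by
  unfold ind; split_ifs <;> norm_num

theorem cubeAvg_projRest_sq (A : Finset (Fin n → ZMod 2)) (I : Finset (Fin n)) :
    cubeAvg (fun x => projRest A I x ^ 2)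
      = cubeAvg (ind A) * (1 - cubeAvg (ind A)) - projVar A I - projVar A Iᶜ := by
  have e : (fun x => projRest A I x ^ 2) = fun x =>
      (1 - 2 * cubeAvg (ind A)) * ind A x + cubeAvg (ind A) ^ 2 + projPart A I x ^ 2
        + projPart A Iᶜ x ^ 2 - 2 * (projPart A I x * ind A x)
        - 2 * (projPart A Iᶜ x * ind A x) + 2 * cubeAvg (ind A) * projPart A I x
        + 2 * cubeAvg (ind A) * projPart A Iᶜ x
        + 2 * (projPart A I x ^ 1 * projPart A Iᶜ x ^ 1) := by
    funext x
    unfold projRest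
    linear_combination ind_sq A x
  rw [e]
  simp only [cubeAvg_add, cubeAvg_sub]
  simp only [cubeAvg_const_mul, cubeAvg_const]
  rw [cubeAvg_projPart_mul_ind, cubeAvg_projPart_mul_ind, cubeAvg_projPart_pow_mul,
    cubeAvg_projPart_pow_one]
  have h1 : cubeAvg (fun x => ind A x) = cubeAvg (ind A) := rfl
  have h2 : cubeAvg (fun x => projPart A I x) = 0 := cubeAvg_projPart A I
  have h3 : cubeAvg (fun x => projPart A Iᶜ x) = 0 := cubeAvg_projPart A Iᶜ
  have h4 : cubeAvg (fun x => projPart A I x ^ 2) = projVar A I := rfl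
  have h5 : cubeAvg (fun x => projPart A Iᶜ x ^ 2) = projVar A Iᶜ := rfl
  rw [h1, h2, h3, h4, h5]
  ring

/-- Write F = μ + P + Q + R. Since F² = F, (μ+P+Q)² - (μ+P+Q) = R² - R(2F-1). Multiply by PQ and
average: P and Q are independent with mean zero, so only 2 E P² E Q² survives on the left. -/
theorem two_mul_projVar_mul_projVar_le (A : Finset (Fin n → ZMod 2)) (I : Finset (Fin n)) {t : ℝ}
    (ht : 0 < t) :
    2 * (projVar A I * projVar A Iᶜ)
      ≤ (1 / (2 * t) + 1) * cubeAvg (fun x => projRest A I x ^ 2) + t / 2 := by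
  set μ := cubeAvg (ind A) with hμ
  have hpt : ∀ x, 2 * (projPart A I x ^ 2 * projPart A Iᶜ x ^ 2)
      + projPart A I x ^ 3 * projPart A Iᶜ x ^ 1 + projPart A I x ^ 1 * projPart A Iᶜ x ^ 3
      - (1 - 2 * μ) * (projPart A I x ^ 2 * projPart A Iᶜ x ^ 1)
      - (1 - 2 * μ) * (projPart A I x ^ 1 * projPart A Iᶜ x ^ 2)
      - (μ * (1 - μ)) * (projPart A I x ^ 1 * projPart A Iᶜ x ^ 1)
      ≤ (1 / (2 * t) + 1) * projRest A I x ^ 2 + t / 2 := by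
    intro x
    have hP := projPart_mem_Icc A I x
    have hQ := projPart_mem_Icc A Iᶜ x
    have hF := ind_sq A x
    have hR : ind A x = μ + projPart A I x + projPart A Iᶜ x + projRest A I x := by
      unfold projRest; ring
    have hF2 : (2 * ind A x - 1) ^ 2 = 1 := by linear_combination 4 * hF
    generalize projPart A I x = P at *
    generalize projPart A Iᶜ x = Q at *
    generalize projRest A I x = R at *
    generalize ind A x = F at *
    have hPQ : |P * Q| ≤ 1 := by
      rw [abs_mul]
      exact mul_le_one₀ (abs_le.2 hP) (abs_nonneg _) (abs_le.2 hQ)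
    have hFabs : |2 * F - 1| = 1 := by
      rw [← sq_eq_sq₀ (abs_nonneg _) zero_le_one, sq_abs, hF2, one_pow]
    have key : 2 * (P ^ 2 * Q ^ 2) + P ^ 3 * Q ^ 1 + P ^ 1 * Q ^ 3
        - (1 - 2 * μ) * (P ^ 2 * Q ^ 1) - (1 - 2 * μ) * (P ^ 1 * Q ^ 2)
        - (μ * (1 - μ)) * (P ^ 1 * Q ^ 1) = P * Q * (R ^ 2 - R * (2 * F - 1)) := by
      have hm : μ = F - P - Q - R := by linarith
      rw [hm]
      linear_combination (P * Q) * hF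
    rw [key]
    have h1 : |R ^ 2 - R * (2 * F - 1)| ≤ R ^ 2 + |R| := by
      refine (abs_sub _ _).trans ?_
      rw [abs_mul, hFabs, mul_one, abs_of_nonneg (sq_nonneg R)]
    -- AM-GM with free parameter t, balanced later against E R² of order t².
    have h2 : |R| ≤ 1 / (2 * t) * R ^ 2 + t / 2 := by
      have : 1 / (2 * t) * R ^ 2 + t / 2 - |R| = 1 / (2 * t) * (|R| - t) ^ 2 := by
        rw [← sq_abs R]; field_simp; ring
      have : 0 ≤ 1 / (2 * t) * (|R| - t) ^ 2 := by positivity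
      linarith
    calc P * Q * (R ^ 2 - R * (2 * F - 1)) ≤ |P * Q * (R ^ 2 - R * (2 * F - 1))| := le_abs_self _
      _ = |P * Q| * |R ^ 2 - R * (2 * F - 1)| := abs_mul _ _
      _ ≤ 1 * |R ^ 2 - R * (2 * F - 1)| := by gcongr
      _ ≤ R ^ 2 + |R| := by rw [one_mul]; exact h1
      _ ≤ _ := by linarith
  have h := cubeAvg_mono hpt
  simp only [cubeAvg_add, cubeAvg_sub, cubeAvg_const_mul, cubeAvg_const,
    cubeAvg_projPart_pow_mul, cubeAvg_projPart_pow_one] at h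
  simp only [projVar]
  linarith

/-- The proportion of vertices of `A` whose only boundary edge has direction `i`. -/
noncomputable def soleBd (A : Finset (Fin n → ZMod 2)) (i : Fin n) : ℝ :=
  cubeAvg fun x => if bdDeg A Finset.univ x = 1 then (bdDeg A {i} x : ℝ) else 0

theorem bdDeg_eq_sum (A : Finset (Fin n → ZMod 2)) (K : Finset (Fin n)) (x : Fin n → ZMod 2) :
    bdDeg A K x = ∑ i ∈ K, bdDeg A {i} x := by
  induction K using Finset.induction_on with
  | empty => simp [bdDeg]
  | insert i K hi ih => rw [bdDeg_insert hi, Finset.sum_insert hi, ih, add_comm]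

theorem bdDeg_mono (A : Finset (Fin n → ZMod 2)) {K L : Finset (Fin n)} (h : K ⊆ L)
    (x : Fin n → ZMod 2) : bdDeg A K x ≤ bdDeg A L x := by
  rw [bdDeg_eq_sum A K, bdDeg_eq_sum A L]
  exact Finset.sum_le_sum_of_subset h

theorem sum_soleBd (A : Finset (Fin n → ZMod 2)) (K : Finset (Fin n)) :
    ∑ i ∈ K, soleBd A i
      = cubeAvg fun x => if bdDeg A Finset.univ x = 1 then (bdDeg A K x : ℝ) else 0 := by
  unfold soleBd cubeAvg
  rw [← Finset.sum_div, Finset.sum_comm]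
  congr 1
  refine Finset.sum_congr rfl fun x _ => ?_
  dsimp only
  split_ifs
  · rw [bdDeg_eq_sum A K]; push_cast; rfl
  · simp

theorem sum_soleBd_univ_le (A : Finset (Fin n → ZMod 2)) :
    ∑ i, soleBd A i ≤ cubeAvg (ind A) := by
  rw [sum_soleBd]
  refine cubeAvg_mono fun x => ?_
  split_ifs with h
  · rw [h]
    have : x ∈ A := by
      by_contra hx
      simp [bdDeg, hx] at h
    simp [ind, this]
  · exact ind_nonneg A x

theorem cubeAvg_bdDeg_rpow_le (A : Finset (Fin n → ZMod 2)) (K : Finset (Fin n)) :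
    cubeAvg (fun x => (bdDeg A K x : ℝ) ^ isoExp) ≤ ∑ i ∈ K, soleBd A i
      + cubeAvg fun x => if 2 ≤ bdDeg A Finset.univ x
          then (bdDeg A Finset.univ x : ℝ) ^ isoExp else 0 := by
  rw [sum_soleBd, ← cubeAvg_add]
  refine cubeAvg_mono fun x => ?_
  have hle := bdDeg_mono A (Finset.subset_univ K) x
  generalize bdDeg A Finset.univ x = h at *
  rcases lt_or_ge h 2 with h2 | h2
  · have hz : (0 : ℝ) ^ isoExp = 0 := Real.zero_rpow isoExp_pos.ne'
    interval_cases h <;> interval_cases bdDeg A K x <;> simp [hz]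
  · rw [if_pos h2, if_neg (by omega), zero_add]
    exact Real.rpow_le_rpow (Nat.cast_nonneg _) (by exact_mod_cast hle) isoExp_pos.le

/-- Adding indices one at a time takes the sum from 0 to at least 1/2 - κ without landing strictly
between κ and 1/2 - κ, so one index must jump the gap. -/
theorem exists_jump {ι : Type*} [Fintype ι] [DecidableEq ι] (p : ι → ℝ) {κ : ℝ} (h0 : 0 ≤ κ)
    (hκ : κ < 1 / 2 - κ) (h : ∀ I : Finset ι, ∑ i ∈ I, p i ≤ κ ∨ 1 / 2 - κ ≤ ∑ i ∈ I, p i)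
    (huniv : 1 / 2 - κ ≤ ∑ i, p i) : ∃ i, 1 / 2 - 2 * κ ≤ p i := by
  by_contra! hcon
  have : ∀ I : Finset ι, ∑ i ∈ I, p i ≤ κ := by
    intro I
    induction I using Finset.induction_on with
    | empty => simpa using h0
    | insert i I hi ih =>
      rcases h (insert i I) with h1 | h1
      · exact h1
      · rw [Finset.sum_insert hi] at h1
        linarith [hcon i]
  linarith [this Finset.univ]

theorem exists_projVar_singleton_ge (A : Finset (Fin n → ZMod 2)) {t : ℝ} (ht : 0 < t)
    (ht1 : t ≤ 1 / 1000) (hμ0 : 1 / 2 ≤ cubeAvg (ind A)) (hμ1 : cubeAvg (ind A) ≤ 1 / 2 + t ^ 2)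
    (hbd : cubeAvg (fun x => if 2 ≤ bdDeg A Finset.univ x
          then (bdDeg A Finset.univ x : ℝ) ^ isoExp else 0) ≤ t ^ 2) :
    ∃ i, 1 / 4 - 20 * t ≤ projVar A {i} := by
  set μ := cubeAvg (ind A) with hμ
  have htt : t ^ 2 ≤ t / 1000 := by nlinarith
  have hM0 : 1 / 4 - t ^ 2 ≤ μ * (1 - μ) := by nlinarith
  have hlow : ∀ I : Finset (Fin n),
      2 * (μ * (1 - μ) - projVar A I) - t ^ 2 ≤ ∑ i ∈ Iᶜ, soleBd A i := by
    intro I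
    linarith [cubeAvg_isoperimetric A I, cubeAvg_bdDeg_rpow_le A Iᶜ]
  have hsum : ∀ I : Finset (Fin n),
      ∑ i ∈ I, soleBd A i + ∑ i ∈ Iᶜ, soleBd A i ≤ 1 / 2 + t ^ 2 := by
    intro I
    rw [Finset.sum_add_sum_compl]
    linarith [sum_soleBd_univ_le A]
  have hdich : ∀ I : Finset (Fin n),
      ∑ i ∈ I, soleBd A i ≤ 19 * t ∨ 1 / 2 - 19 * t ≤ ∑ i ∈ I, soleBd A i := by
    intro I
    have h1 := hlow I
    have h2 := hlow Iᶜ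
    rw [compl_compl] at h2
    have h3 := hsum I
    have h4 := cubeAvg_projRest_sq A I
    have h5 := two_mul_projVar_mul_projVar_le A I ht
    have h6 : 0 ≤ cubeAvg (fun x => projRest A I x ^ 2) := cubeAvg_nonneg fun x => sq_nonneg _
    have h7 := projVar_nonneg A I
    have h8 := projVar_nonneg A Iᶜ
    have hM1 : μ * (1 - μ) ≤ 1 / 4 := by nlinarith [sq_nonneg (μ - 1 / 2)]
    rw [← hμ] at h4
    generalize cubeAvg (fun x => projRest A I x ^ 2) = r at *
    generalize projVar A I = v at *
    generalize projVar A Iᶜ = w at *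
    -- Add the lower bounds for I and its complement: the sole-boundary masses total at most 1/2 +
    -- t², which leaves O(t²) for the rest.
    have hr : r ≤ 3 * t ^ 2 := by linarith
    have h9 : (1 / (2 * t) + 1) * r ≤ 3 / 2 * t + 3 * t ^ 2 := by
      calc (1 / (2 * t) + 1) * r ≤ (1 / (2 * t) + 1) * (3 * t ^ 2) := by gcongr
        _ = _ := by field_simp
    have h10 : v * w ≤ 11 / 10 * t := by linarith
    have h11 : 1 / 4 - 4 * t ^ 2 ≤ v + w := by linarith
    -- The larger variance is about 1/8 or more, so v w = O(t) makes the smaller one O(t).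
    rcases le_total v w with hvw | hvw
    · left
      have : v ≤ 9 * t := by nlinarith
      linarith
    · right
      have : w ≤ 9 * t := by nlinarith
      linarith
  obtain ⟨i, hi⟩ := exists_jump (soleBd A) (κ := 19 * t) (by linarith) (by linarith) hdich (by
    have h1 := hlow ∅
    have h2 : projVar A ∅ = 0 := by
      have : ∀ x, projPart A ∅ x = 0 := fun x => by
        unfold projPart
        rw [condAvg_eq_cubeAvg (fun i hi => absurd (by simp : i ∈ (∅ : Finset (Fin n))ᶜ) hi), sub_self]
      simp only [projVar, this]
      rw [cubeAvg_const]
      norm_num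
    rw [h2, Finset.compl_empty] at h1
    linarith)
  refine ⟨i, ?_⟩
  have h1 := hlow {i}
  have h2 := hsum {i}
  rw [Finset.sum_singleton] at h2
  linarith

/-- The projection onto coordinate i has mean zero and depends on one bit, so it is ±g with g² the
variance. The distance from A to the matching half-cube is exactly 1/2 - g. -/
theorem exists_halfcube_near (A : Finset (Fin n → ZMod 2)) {t : ℝ} {i : Fin n} (ht : 0 ≤ t)
    (hv : 1 / 4 - t ≤ projVar A {i}) :
    ∃ c : ZMod 2, cubeAvg (fun x => if x ∈ A ↔ x i = c then 0 else 1) ≤ 2 * t := by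
  have hflip : ∀ x, projPart A {i} (flipCoord x i) = - projPart A {i} x := by
    intro x
    have h1 : condAvg Finset.univ (ind A) x = cubeAvg (ind A) :=
      condAvg_eq_cubeAvg (fun i hi => absurd (Finset.mem_univ i) hi) x
    have h2 : (Finset.univ : Finset (Fin n)) = insert i {i}ᶜ := by ext j; simp
    rw [h2, condAvg_insert (by simp)] at h1
    unfold projPart
    linarith
  have hinv : ∀ j, j ≠ i → ∀ x, projPart A {i} (flipCoord x j) = projPart A {i} x :=
    fun j hj x => projPart_flipCoord A (by simpa using hj) x
  have hsq : ∀ x, projPart A {i} x ^ 2 = projVar A {i} := by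
    intro x
    have : (fun y => projPart A {i} y ^ 2) = fun _ => projPart A {i} x ^ 2 := by
      funext y
      refine eq_of_flipCoord_invariant (f := fun y => projPart A {i} y ^ 2) (fun j z => ?_) y x
      by_cases hj : j = i
      · subst hj; simp only [hflip, neg_sq]
      · simp only [hinv j hj z]
    rw [projVar, this, cubeAvg_const]
  obtain ⟨x₀, hx₀⟩ : ∃ x₀, 0 ≤ projPart A {i} x₀ := by
    rcases le_total 0 (projPart A {i} 0) with h | h
    · exact ⟨0, h⟩
    · exact ⟨flipCoord 0 i, by rw [hflip]; linarith⟩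
  have hg : 1 / 2 - 2 * t ≤ projPart A {i} x₀ := by
    have := hsq x₀
    nlinarith
  set g := projPart A {i} x₀ with hgdef
  set σ : (Fin n → ZMod 2) → ℝ := fun x => if x i = x₀ i then 1 else -1 with hσ
  have hσflip : ∀ x, σ (flipCoord x i) = - σ x := by
    intro x
    simp only [hσ, flipCoord_same]
    generalize x i = a
    generalize x₀ i = b
    have h2 : a + 1 = b ↔ ¬ a = b := by revert a b; decide
    by_cases h : a = b <;> simp [h2, h]
  have hσinv : ∀ j, j ≠ i → ∀ x, σ (flipCoord x j) = σ x := by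
    intro j hj x
    simp only [hσ, flipCoord_of_ne x hj.symm]
  have hσsq : ∀ x, σ x * σ x = 1 := by
    intro x; simp only [hσ]; split_ifs <;> norm_num
  have hproj : ∀ x, σ x * projPart A {i} x = g := by
    intro x
    have h1 : σ x₀ * projPart A {i} x₀ = g := by simp [hσ, hgdef]
    rw [← h1]
    refine eq_of_flipCoord_invariant (f := fun y => σ y * projPart A {i} y) (fun j z => ?_) x x₀
    by_cases hj : j = i
    · subst hj; simp only [hflip, hσflip, neg_mul_neg]
    · simp only [hinv j hj, hσinv j hj]
  have hσavg : cubeAvg σ = 0 := by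
    have h1 := cubeAvg_comp_flipCoord σ i
    have h2 : (fun x => σ (flipCoord x i)) = fun x => (-1) * σ x := by
      funext x; rw [hσflip]; ring
    rw [h2, cubeAvg_const_mul] at h1
    linarith
  have hσF : cubeAvg (fun x => σ x * ind A x) = g := by
    rw [← cubeAvg_condAvg {i}ᶜ]
    have : condAvg {i}ᶜ (fun x => σ x * ind A x) = fun x => cubeAvg (ind A) * σ x + g := by
      funext x
      rw [condAvg_mul_of_invariant fun j hj x => hσinv j (by simpa using hj) x, ← hproj x]
      unfold projPart
      ring
    rw [this, cubeAvg_add, cubeAvg_const_mul, cubeAvg_const]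
    have : cubeAvg (fun x => σ x) = 0 := hσavg
    rw [this]
    ring
  refine ⟨x₀ i, ?_⟩
  have hD : (fun x => if x ∈ A ↔ x i = x₀ i then (0 : ℝ) else 1)
      = fun x => 1 / 2 + (1 / 2) * σ x - σ x * ind A x := by
    funext x
    simp only [hσ, ind]
    by_cases h1 : x ∈ A <;> by_cases h2 : x i = x₀ i <;> simp [h1, h2] <;> norm_num
  rw [hD, cubeAvg_sub, cubeAvg_add, cubeAvg_const_mul, cubeAvg_const, hσF]
  have : cubeAvg (fun x => σ x) = 0 := hσavg
  rw [this]
  linarith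

/-- Stability for the isoperimetric inequality: a set of measure about `1/2` for which vertices
with at least two boundary edges contribute little is close to a codimension-one subcube. -/
theorem isoperimetric_stability (A : Finset (Fin n → ZMod 2)) {t : ℝ} (ht : 0 < t)
    (ht1 : t ≤ 1 / 20000) (hμ0 : 1 / 2 ≤ cubeAvg (ind A))
    (hμ1 : cubeAvg (ind A) ≤ 1 / 2 + t ^ 2)
    (hbd : cubeAvg (fun x => if 2 ≤ bdDeg A Finset.univ x
          then (bdDeg A Finset.univ x : ℝ) ^ isoExp else 0) ≤ t ^ 2) :
    ∃ (i : Fin n) (c : ZMod 2),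
      cubeAvg (fun x => if x ∈ A ↔ x i = c then 0 else 1) ≤ 40 * t := by
  obtain ⟨i, hi⟩ := exists_projVar_singleton_ge A ht (by linarith) hμ0 hμ1 hbd
  obtain ⟨c, hc⟩ := exists_halfcube_near A (t := 20 * t) (by linarith) hi
  exact ⟨i, c, by linarith⟩

end Stability

/-! ### Vertex sets of induced matchings. -/

section PartneredSets

variable {n : ℕ}

/-- The number of neighbours of `x` in `W`. -/
def inDeg (W : Finset (Fin n → ZMod 2)) (x : Fin n → ZMod 2) : ℕ :=
  (Finset.univ.filter fun i => flipCoord x i ∈ W).card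

/-- The number of neighbours of `x` outside `W`. -/
def outDeg (W : Finset (Fin n → ZMod 2)) (x : Fin n → ZMod 2) : ℕ :=
  (Finset.univ.filter fun i => flipCoord x i ∉ W).card

/-- Every vertex of `W` has exactly one neighbour in `W`. -/
def IsPartnered (W : Finset (Fin n → ZMod 2)) : Prop :=
  ∀ x ∈ W, ∃! i, flipCoord x i ∈ W

theorem inDeg_add_outDeg (W : Finset (Fin n → ZMod 2)) (x : Fin n → ZMod 2) :
    inDeg W x + outDeg W x = n := by
  unfold inDeg outDeg
  rw [Finset.card_filter_add_card_filter_not, Finset.card_univ, Fintype.card_fin]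

theorem IsPartnered.inDeg_eq_one {W : Finset (Fin n → ZMod 2)} (hW : IsPartnered W)
    {x : Fin n → ZMod 2} (hx : x ∈ W) : inDeg W x = 1 := by
  obtain ⟨i, hi, huniq⟩ := hW x hx
  refine Finset.card_eq_one.2 ⟨i, ?_⟩
  ext j
  simp only [Finset.mem_filter, Finset.mem_univ, true_and, Finset.mem_singleton]
  exact ⟨huniq j, fun h => h ▸ hi⟩

theorem sum_inDeg_comm (P Q : Finset (Fin n → ZMod 2)) :
    ∑ x ∈ P, inDeg Q x = ∑ x ∈ Q, inDeg P x := by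
  have h : ∀ P Q : Finset (Fin n → ZMod 2), ∑ x ∈ P, inDeg Q x
      = ∑ i, ∑ x, if x ∈ P ∧ flipCoord x i ∈ Q then 1 else 0 := by
    intro P Q
    rw [Finset.sum_comm, ← Finset.sum_filter_add_sum_filter_not Finset.univ (· ∈ P)]
    rw [Finset.sum_eq_zero (s := Finset.univ.filter (· ∉ P))
      (fun x hx => by simp [(Finset.mem_filter.1 hx).2]), add_zero, Finset.filter_univ_mem]
    refine Finset.sum_congr rfl fun x hx => ?_
    simp [inDeg, hx]
  rw [h, h]
  refine Finset.sum_congr rfl fun i _ => ?_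
  rw [← sum_comp_flipCoord _ i]
  refine Finset.sum_congr rfl fun x _ => ?_
  simp only [flipCoord_flipCoord, and_comm]

/-- If all neighbours of x were in W, the partner of one of them would be x flipped in two
directions, which has two neighbours of x as neighbours in W. -/
theorem IsPartnered.one_le_outDeg {W : Finset (Fin n → ZMod 2)} (hW : IsPartnered W)
    (hn : 1 ≤ n) {x : Fin n → ZMod 2} (hx : x ∉ W) : 1 ≤ outDeg W x := by
  by_contra! hlt
  have h0 : ∀ i, flipCoord x i ∈ W := by
    intro i
    by_contra hi
    have : 0 < outDeg W x := Finset.card_pos.2 ⟨i, by simp [hi]⟩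
    omega
  have i : Fin n := ⟨0, hn⟩
  obtain ⟨j, hj, -⟩ := hW _ (h0 i)
  have hij : i ≠ j := by
    rintro rfl
    rw [flipCoord_flipCoord] at hj
    exact hx hj
  exact hij ((hW _ hj).unique (y₁ := j) (y₂ := i) (by rw [flipCoord_flipCoord]; exact h0 i)
    (by rw [flipCoord_comm, flipCoord_flipCoord]; exact h0 j)).symm

/-- Count two-step walks x, x^j, x^{ji} with x^j outside W and the end in W, grouped by i. If x^i is
in W, its single partner allows at most one j; otherwise j = i is excluded, as it returns to x. -/
theorem IsPartnered.sum_inDeg_le {W : Finset (Fin n → ZMod 2)} (hW : IsPartnered W)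
    {x : Fin n → ZMod 2} (hx : x ∉ W) :
    ∑ j with flipCoord x j ∉ W, inDeg W (flipCoord x j)
      ≤ inDeg W x + outDeg W x * (outDeg W x - 1) := by
  have h1 : ∑ j with flipCoord x j ∉ W, inDeg W (flipCoord x j)
      = ∑ i, ((Finset.univ.filter fun j => flipCoord x j ∉ W).filter
          fun j => flipCoord (flipCoord x i) j ∈ W).card := by
    simp only [inDeg, Finset.card_filter]
    rw [Finset.sum_comm]
    simp only [flipCoord_comm]
  rw [h1, ← Finset.sum_filter_add_sum_filter_not Finset.univ (fun i => flipCoord x i ∈ W)]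
  refine add_le_add ?_ ?_
  · have : ∀ i ∈ Finset.univ.filter (fun i => flipCoord x i ∈ W),
        ((Finset.univ.filter fun j => flipCoord x j ∉ W).filter
          fun j => flipCoord (flipCoord x i) j ∈ W).card ≤ 1 := by
      intro i hi
      rw [← hW.inDeg_eq_one (Finset.mem_filter.1 hi).2]
      exact Finset.card_le_card (Finset.filter_subset_filter _ (Finset.subset_univ _))
    exact (Finset.sum_le_card_nsmul _ _ 1 this).trans (by simp [inDeg])
  · have : ∀ i ∈ Finset.univ.filter (fun i => ¬ flipCoord x i ∈ W),
        ((Finset.univ.filter fun j => flipCoord x j ∉ W).filter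
          fun j => flipCoord (flipCoord x i) j ∈ W).card ≤ outDeg W x - 1 := by
      intro i hi
      rw [outDeg, ← Finset.card_erase_of_mem hi]
      refine Finset.card_le_card fun j hj => ?_
      rw [Finset.mem_filter] at hj
      refine Finset.mem_erase.2 ⟨?_, hj.1⟩
      rintro rfl
      rw [flipCoord_flipCoord] at hj
      exact hx hj.2
    exact (Finset.sum_le_card_nsmul _ _ _ this).trans (by simp [outDeg])

theorem IsPartnered.sum_outDeg_sub_one {W : Finset (Fin n → ZMod 2)} (hW : IsPartnered W) :
    ∑ x ∈ Wᶜ, ((outDeg W x : ℝ) - 1) = ((n : ℝ) - 1) * (2 ^ n - 2 * W.card) := by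
  have h1 := sum_inDeg_comm Wᶜ W
  have h2 : ∀ x ∈ W, (inDeg Wᶜ x : ℝ) = n - 1 := by
    intro x hx
    have := inDeg_add_outDeg W x
    rw [hW.inDeg_eq_one hx] at this
    have h3 : inDeg Wᶜ x = outDeg W x := by simp [inDeg, outDeg]
    have h4 : (1 : ℝ) + outDeg W x = n := by exact_mod_cast this
    rw [h3]
    linarith
  have h3 : ∀ x, (outDeg W x : ℝ) - 1 = (n - 1) - inDeg W x := by
    intro x
    have := congrArg (Nat.cast (R := ℝ)) (inDeg_add_outDeg W x)
    push_cast at this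
    linarith
  have h4 : ((∑ x ∈ Wᶜ, inDeg W x : ℕ) : ℝ) = W.card * ((n : ℝ) - 1) := by
    rw [h1]
    push_cast
    rw [Finset.sum_congr rfl h2, Finset.sum_const, nsmul_eq_mul]
  push_cast at h4
  rw [Finset.sum_congr rfl fun x _ => h3 x, Finset.sum_sub_distrib, h4, Finset.sum_const,
    nsmul_eq_mul, Finset.card_compl, Nat.cast_sub (Finset.card_le_univ W), card_cube]
  push_cast
  ring

theorem zmod_two_add_one_eq_one_iff (a : ZMod 2) : a + 1 = 1 ↔ ¬ a = 1 := by revert a; decide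

theorem zmod_two_eq_add_one_iff (a b c : ZMod 2) : b = c + 1 ↔ (a = c ↔ a + b = 1) := by
  revert a b c; decide

/-- The symmetric difference of `W` with the set of even strings. -/
def parityTwist (W : Finset (Fin n → ZMod 2)) : Finset (Fin n → ZMod 2) :=
  Finset.univ.filter fun x => x ∈ W ↔ ∑ j, x j = 1

theorem mem_parityTwist {W : Finset (Fin n → ZMod 2)} {x : Fin n → ZMod 2} :
    x ∈ parityTwist W ↔ (x ∈ W ↔ ∑ j, x j = 1) := by
  simp [parityTwist]

theorem flipCoord_notMem_parityTwist {W : Finset (Fin n → ZMod 2)} {x : Fin n → ZMod 2}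
    (hx : x ∈ parityTwist W) {i : Fin n} (hi : flipCoord x i ∉ parityTwist W) :
    flipCoord x i ∈ W ↔ x ∈ W := by
  rw [mem_parityTwist] at hx hi
  rw [sum_flipCoord, zmod_two_add_one_eq_one_iff] at hi
  tauto

/-- Each edge inside W joins an even and an odd string, so W has equally many of both and the twist
preserves the measure of the even strings. -/
theorem IsPartnered.cubeAvg_parityTwist {W : Finset (Fin n → ZMod 2)} (hW : IsPartnered W)
    (hn : 1 ≤ n) : cubeAvg (ind (parityTwist W)) = 1 / 2 := by
  set E := W.filter fun x => ¬ ∑ j, x j = 1 with hE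
  set O := W.filter fun x => ∑ j, x j = 1 with hO
  have hEO : E.card = O.card := by
    have h1 : ∀ x ∈ E, inDeg O x = 1 := by
      intro x hx
      rw [hE, Finset.mem_filter] at hx
      rw [← hW.inDeg_eq_one hx.1]
      simp only [inDeg, hO, Finset.mem_filter, sum_flipCoord, zmod_two_add_one_eq_one_iff, hx.2,
        not_false_eq_true, and_true]
    have h2 : ∀ x ∈ O, inDeg E x = 1 := by
      intro x hx
      rw [hO, Finset.mem_filter] at hx
      rw [← hW.inDeg_eq_one hx.1]
      simp only [inDeg, hE, Finset.mem_filter, sum_flipCoord, zmod_two_add_one_eq_one_iff, hx.2,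
        not_true_eq_false, not_false_eq_true, and_true]
    have h3 := sum_inDeg_comm E O
    rwa [Finset.sum_congr rfl h1, Finset.sum_congr rfl h2, Finset.sum_const, Finset.sum_const,
      smul_eq_mul, smul_eq_mul, mul_one, mul_one] at h3
  have hind : ∀ x, ind (parityTwist W) x
      = (if ∑ j, x j = 1 then 0 else 1) + ind O x - ind E x := by
    intro x
    unfold ind
    simp only [mem_parityTwist, hO, hE, Finset.mem_filter]
    by_cases h1 : x ∈ W <;> by_cases h2 : ∑ j, x j = 1 <;> simp [h1, h2]
  have hcard : ∀ S : Finset (Fin n → ZMod 2), cubeAvg (fun x => ind S x) = S.card / 2 ^ n := by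
    intro S
    simp [cubeAvg, ind]
  have heven : cubeAvg (fun x : Fin n → ZMod 2 => if ∑ j, x j = 1 then (0 : ℝ) else 1)
      = 1 / 2 := by
    have h1 := cubeAvg_comp_flipCoord
      (fun x : Fin n → ZMod 2 => if ∑ j, x j = 1 then (0 : ℝ) else 1) ⟨0, hn⟩
    have h2 : (fun x : Fin n → ZMod 2 =>
        if ∑ j, flipCoord x ⟨0, hn⟩ j = 1 then (0 : ℝ) else 1)
        = fun x => 1 - if ∑ j, x j = 1 then (0 : ℝ) else 1 := by
      funext x
      simp only [sum_flipCoord, zmod_two_add_one_eq_one_iff]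
      by_cases h : ∑ j, x j = 1 <;> simp [h]
    rw [h2, cubeAvg_sub, cubeAvg_const] at h1
    linarith
  rw [show ind (parityTwist W) = _ from funext hind, cubeAvg_sub, cubeAvg_add, hcard, hcard,
    hEO, heven]
  ring

/-- The vertices outside `W` a quarter of whose neighbours lie outside `W`. -/
def looseSet (W : Finset (Fin n → ZMod 2)) : Finset (Fin n → ZMod 2) :=
  Finset.univ.filter fun x => x ∉ W ∧ n ≤ 4 * outDeg W x

theorem mem_looseSet {W : Finset (Fin n → ZMod 2)} {x : Fin n → ZMod 2} :
    x ∈ looseSet W ↔ x ∉ W ∧ n ≤ 4 * outDeg W x := by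
  simp [looseSet]

theorem bdDeg_le (A : Finset (Fin n → ZMod 2)) (K : Finset (Fin n)) (x : Fin n → ZMod 2) :
    bdDeg A K x ≤ K.card := by
  unfold bdDeg
  split_ifs
  · exact Finset.card_filter_le _ _
  · exact Nat.zero_le _

theorem outDeg_le (W : Finset (Fin n → ZMod 2)) (x : Fin n → ZMod 2) : outDeg W x ≤ n := by
  have := inDeg_add_outDeg W x
  omega

theorem le_of_mem_looseSet {W : Finset (Fin n → ZMod 2)} (hn : 8 ≤ n) {x : Fin n → ZMod 2}
    (hx : x ∈ looseSet W) : (n : ℝ) ≤ 8 * ((outDeg W x : ℝ) - 1) := by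
  have h1 : (n : ℝ) ≤ 4 * outDeg W x := by exact_mod_cast (mem_looseSet.1 hx).2
  have h2 : (8 : ℝ) ≤ n := by exact_mod_cast hn
  linarith

/-- The hypothesis gives s ≤ 4m(g/m)², and (g/m)^(2β) ≤ g/m because g ≤ m and 2β > 1. -/
theorem rpow_isoExp_le {s g m : ℝ} (hs : 0 ≤ s) (hg : 0 ≤ g) (hm : 0 < m) (hgm : g ≤ m)
    (h : s * m ≤ 4 * g ^ 2) : s ^ isoExp ≤ 8 * g * m ^ (isoExp - 1) := by
  have h4 : (4 : ℝ) ^ isoExp ≤ 4 := by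
    calc (4 : ℝ) ^ isoExp ≤ 4 ^ (1 : ℝ) :=
          Real.rpow_le_rpow_of_exponent_le (by norm_num) isoExp_lt_one.le
      _ = 4 := Real.rpow_one 4
  have hgm1 : g / m ≤ 1 := (div_le_one hm).2 hgm
  have h5 : ((g / m) ^ 2) ^ isoExp ≤ g / m := by
    rcases hg.eq_or_lt with rfl | hg0
    · simp [Real.zero_rpow isoExp_pos.ne']
    · rw [← Real.rpow_natCast (g / m) 2, ← Real.rpow_mul (by positivity)]
      calc (g / m) ^ (((2 : ℕ) : ℝ) * isoExp) ≤ (g / m) ^ (1 : ℝ) :=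
            Real.rpow_le_rpow_of_exponent_ge (by positivity) hgm1 (by
              push_cast; linarith [half_lt_isoExp])
        _ = g / m := Real.rpow_one _
  have hs' : s ≤ 4 * (m * (g / m) ^ 2) := by
    have : 4 * (m * (g / m) ^ 2) = 4 * g ^ 2 / m := by field_simp
    rw [this, le_div_iff₀ hm]
    exact h
  calc s ^ isoExp ≤ (4 * (m * (g / m) ^ 2)) ^ isoExp :=
        Real.rpow_le_rpow hs hs' isoExp_pos.le
    _ = 4 ^ isoExp * (m ^ isoExp * ((g / m) ^ 2) ^ isoExp) := by
        rw [Real.mul_rpow (by norm_num) (by positivity), Real.mul_rpow hm.le (by positivity)]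
    _ ≤ 4 * (m ^ isoExp * (g / m)) := by gcongr
    _ = 4 * g * m ^ (isoExp - 1) := by
        rw [Real.rpow_sub_one hm.ne']
        field_simp
    _ ≤ 8 * g * m ^ (isoExp - 1) := by gcongr; norm_num

/-- A loose vertex has excess g = `outDeg` - 1 at least n/8, which pays for n^β. At any other
vertex, boundary edges lead to vertices with over 3n/4 neighbours in W, and the two-step count
limits how many there can be. -/
theorem IsPartnered.bdDeg_rpow_le {W : Finset (Fin n → ZMod 2)} (hW : IsPartnered W)
    (hn : 8 ≤ n) {x : Fin n → ZMod 2}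
    (h2 : 2 ≤ bdDeg (parityTwist W ∪ looseSet W) Finset.univ x) :
    x ∉ W ∧ (bdDeg (parityTwist W ∪ looseSet W) Finset.univ x : ℝ) ^ isoExp
      ≤ 8 * ((outDeg W x : ℝ) - 1) * (n : ℝ) ^ (isoExp - 1) := by
  have hn0 : (0 : ℝ) < n := by exact_mod_cast (by omega : 0 < n)
  have hmem : x ∈ parityTwist W ∪ looseSet W := by
    by_contra hx
    simp [bdDeg, hx] at h2
  by_cases hC : x ∈ looseSet W
  · refine ⟨(mem_looseSet.1 hC).1, ?_⟩
    have h3 : (bdDeg (parityTwist W ∪ looseSet W) Finset.univ x : ℝ) ≤ n := by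
      exact_mod_cast (bdDeg_le _ _ x).trans (by simp)
    calc _ ≤ (n : ℝ) ^ isoExp := Real.rpow_le_rpow (Nat.cast_nonneg _) h3 isoExp_pos.le
      _ = n * (n : ℝ) ^ (isoExp - 1) := by
        rw [Real.rpow_sub_one hn0.ne']
        field_simp
      _ ≤ _ := by
        gcongr
        exact le_of_mem_looseSet hn hC
  have hA : x ∈ parityTwist W := by
    rcases Finset.mem_union.1 hmem with h | h
    · exact h
    · exact absurd h hC
  set T := Finset.univ.filter fun i => flipCoord x i ∉ parityTwist W ∪ looseSet W with hT
  have hbd : bdDeg (parityTwist W ∪ looseSet W) Finset.univ x = T.card := by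
    rw [bdDeg, if_pos hmem]
  have hTW : ∀ i ∈ T, (flipCoord x i ∈ W ↔ x ∈ W) ∧ flipCoord x i ∉ looseSet W := by
    intro i hi
    have h3 := (Finset.mem_filter.1 hi).2
    rw [Finset.mem_union, not_or] at h3
    exact ⟨flipCoord_notMem_parityTwist hA h3.1, h3.2⟩
  rw [hbd] at h2 ⊢
  have hxW : x ∉ W := by
    intro hx
    have : T.card ≤ inDeg W x :=
      Finset.card_le_card fun i hi => by simp [(hTW i hi).1, hx]
    rw [hW.inDeg_eq_one hx] at this
    omega
  refine ⟨hxW, ?_⟩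
  have h1 := hW.one_le_outDeg (by omega) hxW
  have hsub : T ⊆ Finset.univ.filter fun i => flipCoord x i ∉ W := by
    intro i hi
    simp [(hTW i hi).1, hxW]
  have hlow : ∀ i ∈ T, 3 * n ≤ 4 * inDeg W (flipCoord x i) := by
    intro i hi
    have h3 := (hTW i hi).2
    rw [mem_looseSet, not_and, not_le] at h3
    have h4 := h3 (by simp [(hTW i hi).1, hxW])
    have h5 := inDeg_add_outDeg W (flipCoord x i)
    omega
  have hsum : T.card * (3 * n) ≤ 4 * (inDeg W x + outDeg W x * (outDeg W x - 1)) := by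
    calc T.card * (3 * n) = ∑ i ∈ T, 3 * n := by simp
      _ ≤ ∑ i ∈ T, 4 * inDeg W (flipCoord x i) := Finset.sum_le_sum hlow
      _ = 4 * ∑ i ∈ T, inDeg W (flipCoord x i) := by rw [Finset.mul_sum]
      _ ≤ _ := by
        gcongr
        exact (Finset.sum_le_sum_of_subset hsub).trans (hW.sum_inDeg_le hxW)
  have hio := inDeg_add_outDeg W x
  have hle : (outDeg W x : ℝ) ≤ n := by exact_mod_cast outDeg_le W x
  refine rpow_isoExp_le (Nat.cast_nonneg _) ?_ hn0 (by linarith) ?_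
  · have : (1 : ℝ) ≤ outDeg W x := by exact_mod_cast h1
    linarith
  -- The count reads 3n|T| ≤ 4(n - 1 + g²). As |T| ≥ 2, the term 4n is absorbed by 2n|T|, leaving
  -- n|T| ≤ 4g².
  · obtain ⟨g, hg⟩ := Nat.exists_eq_add_of_le h1
    rw [hg] at hsum hio ⊢
    have hsum' : (T.card : ℝ) * (3 * n) ≤ 4 * (inDeg W x + (1 + g) * g) := by
      have : 1 + g - 1 = g := by omega
      rw [this] at hsum
      exact_mod_cast hsum
    have hio' : (inDeg W x : ℝ) + (1 + g) = n := by exact_mod_cast hio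
    have h2' : (2 : ℝ) ≤ T.card := by exact_mod_cast h2
    push_cast
    nlinarith

theorem IsPartnered.outDeg_sub_one_nonneg {W : Finset (Fin n → ZMod 2)} (hW : IsPartnered W)
    (hn : 1 ≤ n) {x : Fin n → ZMod 2} (hx : x ∉ W) : 0 ≤ (outDeg W x : ℝ) - 1 := by
  have : (1 : ℝ) ≤ outDeg W x := by exact_mod_cast hW.one_le_outDeg hn hx
  linarith

theorem IsPartnered.cubeAvg_outDeg {W : Finset (Fin n → ZMod 2)} (hW : IsPartnered W) :
    cubeAvg (fun x => if x ∈ W then 0 else (outDeg W x : ℝ) - 1)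
      = ((n : ℝ) - 1) * (2 ^ n - 2 * W.card) / 2 ^ n := by
  rw [← hW.sum_outDeg_sub_one, cubeAvg]
  congr 1
  rw [← Finset.sum_add_sum_compl W, Finset.sum_eq_zero fun x hx => if_pos hx, zero_add]
  exact Finset.sum_congr rfl fun x hx => if_neg (Finset.mem_compl.1 hx)

theorem IsPartnered.two_mul_card_le {W : Finset (Fin n → ZMod 2)} (hW : IsPartnered W)
    (hn : 2 ≤ n) : 2 * (W.card : ℝ) ≤ 2 ^ n := by
  have h1 : 0 ≤ ∑ x ∈ Wᶜ, ((outDeg W x : ℝ) - 1) := Finset.sum_nonneg fun x hx =>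
    hW.outDeg_sub_one_nonneg (by omega) (Finset.mem_compl.1 hx)
  rw [hW.sum_outDeg_sub_one] at h1
  have h2 : (2 : ℝ) ≤ n := by exact_mod_cast hn
  linarith [nonneg_of_mul_nonneg_right h1 (by linarith : (0 : ℝ) < n - 1)]

/-- A large set of vertices inducing a perfect matching is close to the vertex set of a canonical
matching. -/
theorem IsPartnered.exists_near_parity {W : Finset (Fin n → ZMod 2)} (hW : IsPartnered W)
    (hn : 8 ≤ n) {δ t : ℝ} (hcard : (2 : ℝ) ^ n - 2 * W.card ≤ δ * 2 ^ n) (ht : 0 < t)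
    (ht1 : t ≤ 1 / 20000) (hδ : 8 * (n : ℝ) ^ isoExp * δ ≤ t ^ 2) :
    ∃ (i : Fin n) (ε : ZMod 2),
      cubeAvg (fun x => if x ∈ W ↔ ∑ j ∈ Finset.univ.erase i, x j = ε then 0 else 1)
        ≤ 41 * t := by
  have hn1 : (1 : ℝ) ≤ n := by exact_mod_cast (by omega : 1 ≤ n)
  have hn0 : (0 : ℝ) < n := by linarith
  set D : ℝ := cubeAvg (fun x => if x ∈ W then 0 else (outDeg W x : ℝ) - 1) with hD
  have hpt : ∀ x, 0 ≤ if x ∈ W then 0 else (outDeg W x : ℝ) - 1 := by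
    intro x
    split_ifs with h
    · exact le_rfl
    · exact hW.outDeg_sub_one_nonneg (by omega) h
  have hD0 : 0 ≤ D := cubeAvg_nonneg hpt
  have hDle : D ≤ n * δ := by
    have h1 := hW.cubeAvg_outDeg
    rw [← hD] at h1
    have h2 : ((2 : ℝ) ^ n - 2 * W.card) / 2 ^ n ≤ δ := by
      rw [div_le_iff₀ (by positivity)]
      exact hcard
    rw [mul_div_assoc] at h1
    have h3 : 0 ≤ ((2 : ℝ) ^ n - 2 * W.card) / 2 ^ n :=
      div_nonneg (by linarith [hW.two_mul_card_le (by omega)]) (by positivity)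
    rw [h1]
    nlinarith
  have hDpow : 8 * (n : ℝ) ^ (isoExp - 1) * D ≤ t ^ 2 := by
    calc 8 * (n : ℝ) ^ (isoExp - 1) * D ≤ 8 * (n : ℝ) ^ (isoExp - 1) * (n * δ) := by gcongr
      _ = 8 * (n : ℝ) ^ isoExp * δ := by
        rw [Real.rpow_sub_one hn0.ne']
        field_simp
      _ ≤ t ^ 2 := hδ
  have hC : cubeAvg (ind (looseSet W)) ≤ t ^ 2 := by
    have h1 : ∀ x, ind (looseSet W) x
        ≤ 8 * (n : ℝ) ^ (isoExp - 1) * if x ∈ W then 0 else (outDeg W x : ℝ) - 1 := by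
      intro x
      by_cases hx : x ∈ looseSet W
      · have h2 := le_of_mem_looseSet hn hx
        rw [if_neg (mem_looseSet.1 hx).1, ind, if_pos hx]
        have h3 : (1 : ℝ) ≤ (n : ℝ) ^ isoExp := Real.one_le_rpow hn1 isoExp_pos.le
        calc (1 : ℝ) ≤ (n : ℝ) ^ isoExp := h3
          _ = (n : ℝ) ^ (isoExp - 1) * n := by
            rw [Real.rpow_sub_one hn0.ne']
            field_simp
          _ ≤ (n : ℝ) ^ (isoExp - 1) * (8 * ((outDeg W x : ℝ) - 1)) := by gcongr
          _ = _ := by ring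
      · rw [ind, if_neg hx]
        exact mul_nonneg (by positivity) (hpt x)
    have h2 := cubeAvg_mono h1
    rw [cubeAvg_const_mul] at h2
    exact h2.trans hDpow
  have hbd : cubeAvg (fun x => if 2 ≤ bdDeg (parityTwist W ∪ looseSet W) Finset.univ x
      then (bdDeg (parityTwist W ∪ looseSet W) Finset.univ x : ℝ) ^ isoExp else 0) ≤ t ^ 2 := by
    have h1 : ∀ x, (if 2 ≤ bdDeg (parityTwist W ∪ looseSet W) Finset.univ x
        then (bdDeg (parityTwist W ∪ looseSet W) Finset.univ x : ℝ) ^ isoExp else 0)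
        ≤ 8 * (n : ℝ) ^ (isoExp - 1) * if x ∈ W then 0 else (outDeg W x : ℝ) - 1 := by
      intro x
      by_cases hx : 2 ≤ bdDeg (parityTwist W ∪ looseSet W) Finset.univ x
      · obtain ⟨h2, h3⟩ := hW.bdDeg_rpow_le hn hx
        rw [if_pos hx, if_neg h2]
        linarith
      · rw [if_neg hx]
        exact mul_nonneg (by positivity) (hpt x)
    have h2 := cubeAvg_mono h1
    rw [cubeAvg_const_mul] at h2
    exact h2.trans hDpow
  have hA := hW.cubeAvg_parityTwist (by omega)
  have hle : ∀ x, ind (parityTwist W) x ≤ ind (parityTwist W ∪ looseSet W) x := by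
    intro x
    unfold ind
    by_cases h1 : x ∈ parityTwist W <;> by_cases h2 : x ∈ looseSet W <;> simp [h1, h2]
  have hle' : ∀ x, ind (parityTwist W ∪ looseSet W) x
      ≤ ind (parityTwist W) x + ind (looseSet W) x := by
    intro x
    unfold ind
    by_cases h1 : x ∈ parityTwist W <;> by_cases h2 : x ∈ looseSet W <;> simp [h1, h2]
  have hμ0 := cubeAvg_mono hle
  have hμ1 := cubeAvg_mono hle'
  rw [cubeAvg_add] at hμ1
  have e1 : cubeAvg (fun x => ind (parityTwist W) x) = 1 / 2 := hA
  have e2 : cubeAvg (fun x => ind (looseSet W) x) ≤ t ^ 2 := hC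
  obtain ⟨i, c, hic⟩ := isoperimetric_stability (parityTwist W ∪ looseSet W) ht ht1
    (hA ▸ hμ0) (hμ1.trans (by rw [e1]; linarith)) hbd
  -- Undoing the twist turns `x i = c` into a parity condition on the other coordinates. The loose
  -- set costs a further t² ≤ t.
  refine ⟨i, c + 1, ?_⟩
  have hfin : ∀ x, (if x ∈ W ↔ ∑ j ∈ Finset.univ.erase i, x j = c + 1 then (0 : ℝ) else 1)
      ≤ (if x ∈ parityTwist W ∪ looseSet W ↔ x i = c then (0 : ℝ) else 1)
        + ind (looseSet W) x := by
    intro x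
    have h1 : (∑ j ∈ Finset.univ.erase i, x j = c + 1) ↔ (x i = c ↔ ∑ j, x j = 1) := by
      rw [← Finset.add_sum_erase _ _ (Finset.mem_univ i)]
      exact zmod_two_eq_add_one_iff _ _ _
    simp only [ind, h1, Finset.mem_union, mem_parityTwist]
    by_cases a1 : x ∈ W <;> by_cases a2 : x ∈ looseSet W <;> by_cases a3 : x i = c <;>
      by_cases a4 : ∑ j, x j = 1 <;> simp [a1, a2, a3, a4]
  have h3 := cubeAvg_mono hfin
  rw [cubeAvg_add] at h3
  nlinarith

end PartneredSets

/-! ### From vertex sets back to edge sets. -/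

section Matchings

variable {n : ℕ} {M : (hammingCube n).Subgraph} {W : Finset (Fin n → ZMod 2)}

theorem IsInducedMatching.adj_flipCoord (hM : IsInducedMatching M) {x : Fin n → ZMod 2}
    {i : Fin n} (hx : x ∈ M.verts) (hi : flipCoord x i ∈ M.verts) : M.Adj x (flipCoord x i) :=
  hM.1 hx hi ((hammingDist_eq_one_iff _ _).2 ⟨i, rfl⟩)

theorem exists_eq_flipCoord_of_adj {x y : Fin n → ZMod 2} (h : M.Adj x y) :
    ∃ i, y = flipCoord x i :=
  (hammingDist_eq_one_iff _ _).1 (M.adj_sub h)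

theorem IsInducedMatching.isPartnered (hM : IsInducedMatching M)
    (hW : ∀ x, x ∈ W ↔ x ∈ M.verts) : IsPartnered W := by
  intro x hx
  rw [hW] at hx
  obtain ⟨y, hy, huniq⟩ := hM.2 hx
  obtain ⟨i, rfl⟩ := exists_eq_flipCoord_of_adj hy
  refine ⟨i, (hW _).2 (M.edge_vert hy.symm), fun j hj => ?_⟩
  exact flipCoord_injective_right x (huniq _ (hM.adj_flipCoord hx ((hW _).1 hj)))

theorem IsInducedMatching.two_mul_ncard_edgeSet (hM : IsInducedMatching M)
    (hW : ∀ x, x ∈ W ↔ x ∈ M.verts) : 2 * M.edgeSet.ncard = W.card := by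
  classical
  have h1 := M.spanningCoe.sum_degrees_eq_twice_card_edges
  have h2 : M.edgeSet.ncard = M.spanningCoe.edgeFinset.card := by
    rw [← Set.ncard_coe_finset, SimpleGraph.coe_edgeFinset]
    rfl
  rw [h2, ← h1, ← Finset.sum_add_sum_compl W, Finset.sum_eq_card_nsmul (b := 1),
    Finset.sum_eq_zero, smul_eq_mul, mul_one, add_zero]
  · intro x hx
    rw [Finset.mem_compl, hW] at hx
    rw [SimpleGraph.Subgraph.degree_spanningCoe]
    exact SimpleGraph.Subgraph.degree_of_notMem_verts hx
  · intro x hx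
    rw [SimpleGraph.Subgraph.degree_spanningCoe]
    exact SimpleGraph.Subgraph.isMatching_iff_forall_degree.1 hM.2 x ((hW x).1 hx)

theorem sum_erase_flipCoord_same (x : Fin n → ZMod 2) (i : Fin n) :
    ∑ j ∈ Finset.univ.erase i, flipCoord x i j = ∑ j ∈ Finset.univ.erase i, x j :=
  Finset.sum_congr rfl fun _ hj => flipCoord_of_ne x (Finset.ne_of_mem_erase hj)

theorem sum_erase_flipCoord_of_ne (x : Fin n → ZMod 2) {i k : Fin n} (h : k ≠ i) :
    ∑ j ∈ Finset.univ.erase i, flipCoord x k j = ∑ j ∈ Finset.univ.erase i, x j + 1 := by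
  have h1 := sum_flipCoord x k
  rw [← Finset.add_sum_erase _ _ (Finset.mem_univ i),
    ← Finset.add_sum_erase (a := i) _ x (Finset.mem_univ i), flipCoord_of_ne x h.symm,
    add_assoc] at h1
  exact add_left_cancel h1

/-- Charge each edge of the symmetric difference to a misclassified endpoint. A vertex of W
determines its matching edge and any other vertex its edge in direction i, so each vertex is charged
at most once. -/
theorem IsInducedMatching.symmDiff_subset (hM : IsInducedMatching M) (i : Fin n) (ε : ZMod 2)
    (hW : ∀ x, x ∈ W ↔ x ∈ M.verts) :
    ∃ f : (Fin n → ZMod 2) → Sym2 (Fin n → ZMod 2), M.edgeSet ∆ canonicalMatching i ε ⊆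
      f '' {x | ¬ (x ∈ W ↔ ∑ j ∈ Finset.univ.erase i, x j = ε)} := by
  classical
  have hex : ∀ x, ∃ e : Sym2 (Fin n → ZMod 2),
      (x ∈ W → ∀ y, M.Adj x y → s(x, y) = e) ∧ (x ∉ W → s(x, flipCoord x i) = e) := by
    intro x
    by_cases hx : x ∈ W
    · obtain ⟨z, hz, huniq⟩ := hM.2 ((hW x).1 hx)
      exact ⟨s(x, z), fun _ y hy => by rw [huniq y hy], fun h => absurd hx h⟩
    · exact ⟨s(x, flipCoord x i), fun h => absurd h hx, fun _ => rfl⟩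
  choose f hf1 hf2 using hex
  refine ⟨f, ?_⟩
  rintro e (⟨he, hne⟩ | ⟨⟨x, hx, rfl⟩, hne⟩)
  · induction e with
    | _ x y =>
    have hxy : M.Adj x y := he
    have hxW : x ∈ W := (hW x).2 (M.edge_vert hxy)
    have hyW : y ∈ W := (hW y).2 (M.edge_vert hxy.symm)
    by_cases hx : ∑ j ∈ Finset.univ.erase i, x j = ε
    · by_cases hy : ∑ j ∈ Finset.univ.erase i, y j = ε
      · obtain ⟨k, rfl⟩ := exists_eq_flipCoord_of_adj hxy
        by_cases hk : k = i
        · subst hk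
          exact absurd ⟨x, hx, rfl⟩ hne
        · rw [sum_erase_flipCoord_of_ne x hk, hx] at hy
          simp at hy
      · exact ⟨y, fun h => hy (h.1 hyW), by rw [← hf1 y hyW x hxy.symm, Sym2.eq_swap]⟩
    · exact ⟨x, fun h => hx (h.1 hxW), (hf1 x hxW y hxy).symm⟩
  · by_cases hxW : x ∈ W
    · by_cases hyW : flipCoord x i ∈ W
      · exact absurd (hM.adj_flipCoord ((hW _).1 hxW) ((hW _).1 hyW)) hne
      · refine ⟨flipCoord x i, fun h => hyW (h.2 ((sum_erase_flipCoord_same x i).trans hx)), ?_⟩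
        rw [← hf2 _ hyW, flipCoord_flipCoord, Sym2.eq_swap]
    · exact ⟨x, fun h => hxW (h.2 hx), (hf2 x hxW).symm⟩

theorem IsInducedMatching.exists_near_canonicalMatching (hM : IsInducedMatching M) (hn : 8 ≤ n)
    {δ t : ℝ} (hcard : (1 - δ) * ((2 : ℝ) ^ n / 4) ≤ (M.edgeSet.ncard : ℝ)) (ht : 0 < t)
    (ht1 : t ≤ 1 / 20000) (hδ : 8 * (n : ℝ) ^ isoExp * δ ≤ t ^ 2) :
    ∃ (i : Fin n) (ε : ZMod 2),
      ((M.edgeSet ∆ canonicalMatching i ε).ncard : ℝ) ≤ 165 * t * (2 : ℝ) ^ n ∧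
      |((M.edgeSet ∩ canonicalMatching i ε).ncard : ℝ) - (2 : ℝ) ^ n / 4|
        ≤ 165 * t * ((2 : ℝ) ^ n / 4) := by
  classical
  obtain ⟨W, hW⟩ : ∃ W : Finset (Fin n → ZMod 2), ∀ x, x ∈ W ↔ x ∈ M.verts :=
    ⟨M.verts.toFinset, fun x => Set.mem_toFinset⟩
  have hP := hM.isPartnered hW
  have hMW : 2 * (M.edgeSet.ncard : ℝ) = W.card := by
    exact_mod_cast hM.two_mul_ncard_edgeSet hW
  have h2n : (0 : ℝ) < 2 ^ n := by positivity
  obtain ⟨i, ε, h⟩ := hP.exists_near_parity hn (δ := δ) (by linarith) ht ht1 hδ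
  refine ⟨i, ε, ?_⟩
  obtain ⟨f, hf⟩ := hM.symmDiff_subset i ε hW
  have hB : (({x | ¬ (x ∈ W ↔ ∑ j ∈ Finset.univ.erase i, x j = ε)} :
      Set (Fin n → ZMod 2)).ncard : ℝ) ≤ 41 * t * 2 ^ n := by
    rw [cubeAvg, div_le_iff₀ h2n] at h
    refine le_trans (le_of_eq ?_) h
    rw [Set.ncard_eq_toFinset_card', Set.toFinset_ofPred, Finset.card_filter]
    push_cast
    refine Finset.sum_congr rfl fun x _ => ?_
    by_cases hx : (x ∈ W ↔ ∑ j ∈ Finset.univ.erase i, x j = ε) <;> simp only [hx] <;> simp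
  have hS : ((M.edgeSet ∆ canonicalMatching i ε).ncard : ℝ) ≤ 41 * t * 2 ^ n := by
    refine le_trans ?_ hB
    exact_mod_cast (Set.ncard_le_ncard hf (Set.toFinite _)).trans
      (Set.ncard_image_le (Set.toFinite _))
  have hdiff : ((M.edgeSet \ canonicalMatching i ε).ncard : ℝ) ≤ 41 * t * 2 ^ n := by
    refine le_trans ?_ hS
    exact_mod_cast Set.ncard_le_ncard (fun e he => Or.inl he) (Set.toFinite _)
  have hsplit : ((M.edgeSet ∩ canonicalMatching i ε).ncard : ℝ)
      + (M.edgeSet \ canonicalMatching i ε).ncard = M.edgeSet.ncard := by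
    exact_mod_cast Set.ncard_inter_add_ncard_sdiff_eq_ncard M.edgeSet (canonicalMatching i ε)
      (Set.toFinite _)
  have hdiff0 : (0 : ℝ) ≤ (M.edgeSet \ canonicalMatching i ε).ncard := Nat.cast_nonneg _
  have hmax := hP.two_mul_card_le (by omega)
  have hδt : δ ≤ t := by
    have h1 : (1 : ℝ) ≤ (n : ℝ) ^ isoExp :=
      Real.one_le_rpow (by exact_mod_cast (by omega : 1 ≤ n)) isoExp_pos.le
    nlinarith
  have h3 : δ * (2 ^ n / 4) ≤ t * (2 ^ n / 4) := by gcongr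
  have h4 : 0 ≤ t * 2 ^ n := by positivity
  -- Relative to N/4 the edges of M outside the canonical matching cost 4 · 41t and the deficit δ ≤
  -- t costs one more t, hence 165.
  refine ⟨by linarith, abs_le.2 ⟨by linarith, by linarith⟩⟩

end Matchings

/-! ### From fixed accuracy to a vanishing error. -/

/-- If a monotone family of properties holds for every positive constant eventually and for some
constant always, then it holds along a sequence tending to zero. -/
theorem exists_tendsto_zero_of_forall_eventually {P : ℕ → ℝ → Prop}
    (hmono : ∀ n s t, s ≤ t → P n s → P n t) (hex : ∀ n, ∃ C, P n C)
    (hev : ∀ ε > 0, ∀ᶠ n in Filter.atTop, P n ε) :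
    ∃ ζ : ℕ → ℝ, Filter.Tendsto ζ Filter.atTop (nhds 0) ∧ ∀ n, P n (ζ n) := by
  have hbdd : ∀ n, BddBelow {s | 0 ≤ s ∧ P n s} := fun n => ⟨0, fun s hs => hs.1⟩
  have hne : ∀ n, {s | 0 ≤ s ∧ P n s}.Nonempty := by
    intro n
    obtain ⟨C, hC⟩ := hex n
    exact ⟨max 0 C, le_max_left _ _, hmono n _ _ (le_max_right _ _) hC⟩
  have h0 : Filter.Tendsto (fun n => sInf {s | 0 ≤ s ∧ P n s}) Filter.atTop (nhds 0) := by
    rw [Metric.tendsto_nhds]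
    intro ε hε
    filter_upwards [hev (ε / 2) (by linarith)] with n hn
    have h1 : sInf {s | 0 ≤ s ∧ P n s} ≤ ε / 2 := csInf_le (hbdd n) ⟨by linarith, hn⟩
    have h2 : 0 ≤ sInf {s | 0 ≤ s ∧ P n s} := le_csInf (hne n) fun s hs => hs.1
    rw [Real.dist_0_eq_abs, abs_of_nonneg h2]
    linarith
  -- The infimum need not be attained, so a positive null sequence is added.
  refine ⟨fun n => sInf {s | 0 ≤ s ∧ P n s} + 1 / ((n : ℝ) + 1), ?_, fun n => ?_⟩
  · simpa using h0.add tendsto_one_div_add_atTop_nhds_zero_nat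
  · obtain ⟨s, hs, hlt⟩ := exists_lt_of_csInf_lt (hne n)
      (lt_add_of_pos_right _ (by positivity : (0 : ℝ) < 1 / ((n : ℝ) + 1)))
    exact hmono n s _ hlt.le hs.2

theorem lemma1p3 (δ : ℕ → ℝ)
    (hδ : δ =o[Filter.atTop] fun n : ℕ => (n : ℝ) ^ (-Real.logb 2 (3 / 2))) :
    ∃ ζ : ℕ → ℝ, Filter.Tendsto ζ Filter.atTop (nhds 0) ∧
      ∀ n : ℕ, 1 ≤ n → ∀ M : (hammingCube n).Subgraph, IsInducedMatching M →
        (1 - δ n) * ((2 : ℝ) ^ n / 4) ≤ (M.edgeSet.ncard : ℝ) →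
          ∃ (i : Fin n) (ε : ZMod 2),
            ((M.edgeSet ∆ canonicalMatching i ε).ncard : ℝ) ≤ ζ n * (2 : ℝ) ^ n ∧
            |((M.edgeSet ∩ canonicalMatching i ε).ncard : ℝ) - (2 : ℝ) ^ n / 4|
              ≤ ζ n * ((2 : ℝ) ^ n / 4) := by
  refine exists_tendsto_zero_of_forall_eventually (P := fun n s => 1 ≤ n →
    ∀ M : (hammingCube n).Subgraph, IsInducedMatching M →
      (1 - δ n) * ((2 : ℝ) ^ n / 4) ≤ (M.edgeSet.ncard : ℝ) →
        ∃ (i : Fin n) (ε : ZMod 2),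
          ((M.edgeSet ∆ canonicalMatching i ε).ncard : ℝ) ≤ s * (2 : ℝ) ^ n ∧
          |((M.edgeSet ∩ canonicalMatching i ε).ncard : ℝ) - (2 : ℝ) ^ n / 4|
            ≤ s * ((2 : ℝ) ^ n / 4)) ?_ ?_ ?_
  · intro n s t hst h hn M hM hcard
    obtain ⟨i, ε, h1, h2⟩ := h hn M hM hcard
    exact ⟨i, ε, h1.trans (by gcongr), h2.trans (by gcongr)⟩
  · intro n
    -- For each fixed n a trivial bound suffices: the 4 offsets the division in N/4, and the 1
    -- covers a small intersection.
    refine ⟨4 * Nat.card (Sym2 (Fin n → ZMod 2)) + 1, fun hn M _ _ => ⟨⟨0, hn⟩, 0, ?_⟩⟩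
    have hle : ∀ S : Set (Sym2 (Fin n → ZMod 2)),
        (S.ncard : ℝ) ≤ Nat.card (Sym2 (Fin n → ZMod 2)) :=
      fun S => by exact_mod_cast Set.ncard_le_card S
    have h2 : (1 : ℝ) ≤ 2 ^ n := one_le_pow₀ (by norm_num)
    have h3 := hle (M.edgeSet ∆ canonicalMatching ⟨0, hn⟩ 0)
    have h4 := hle (M.edgeSet ∩ canonicalMatching ⟨0, hn⟩ 0)
    have h5 : (0 : ℝ) ≤ (M.edgeSet ∩ canonicalMatching ⟨0, hn⟩ 0).ncard := Nat.cast_nonneg _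
    have h6 : (0 : ℝ) ≤ Nat.card (Sym2 (Fin n → ZMod 2)) := Nat.cast_nonneg _
    refine ⟨by nlinarith, abs_le.2 ⟨by nlinarith, by nlinarith⟩⟩
  · intro ε hε
    set t := min (ε / 165) (1 / 20000) with ht
    have ht0 : 0 < t := lt_min (by linarith) (by norm_num)
    have htε : 165 * t ≤ ε := by linarith [min_le_left (ε / 165) (1 / 20000 : ℝ)]
    filter_upwards [hδ.bound (by positivity : 0 < t ^ 2 / 8), Filter.eventually_ge_atTop 8]
      with n hn h8 _ M hM hcard
    have hn0 : (0 : ℝ) < n := by exact_mod_cast (by omega : 0 < n)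
    have hδn : 8 * (n : ℝ) ^ isoExp * δ n ≤ t ^ 2 := by
      rw [Real.norm_eq_abs, Real.norm_eq_abs,
        abs_of_nonneg (Real.rpow_nonneg hn0.le _)] at hn
      have h1 : (n : ℝ) ^ isoExp * (n : ℝ) ^ (-isoExp) = 1 := by
        rw [← Real.rpow_add hn0, add_neg_cancel, Real.rpow_zero]
      calc 8 * (n : ℝ) ^ isoExp * δ n
          ≤ 8 * (n : ℝ) ^ isoExp * (t ^ 2 / 8 * (n : ℝ) ^ (-isoExp)) := by
            gcongr
            exact (le_abs_self _).trans hn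
        _ = t ^ 2 * ((n : ℝ) ^ isoExp * (n : ℝ) ^ (-isoExp)) := by ring
        _ = t ^ 2 := by rw [h1, mul_one]
    obtain ⟨i, c, h1, h2⟩ :=
      hM.exists_near_canonicalMatching h8 hcard ht0 (min_le_right _ _) hδn
    exact ⟨i, c, h1.trans (by gcongr), h2.trans (by gcongr)⟩
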